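/- **Theorem 1.6.** Let $d\ge 2$ and let $B^d$ be the open unit ball of $\mathbb R^d$. *Definitions.* A map $f$ on a domain $U\subset\mathbb R^d$ is quasiregular with maximal distortion at most $K\ge 1$ if it is continuous, belongs to $W^{1}_{d,\mathrm{loc}}(U)$, and satisfies $|f'(x)|^d\le K J_f(x)$ and $J_f(x)\le K\inf_{|v|=1}|f'(x)v|^d$ for almost every $x\in U$; it is quasiconformal if it is also injective. A map $f:U\to U$ (not necessarily onto) is uniformly quasiconformal if all iterates $f^n$, $n\ge1$, are quasiconformal on $U$ with a common bound on the maximal distortion. With $\mu$ Lebesgue measure and $$\rho_f(\delta)=\Big(\frac{\mu[f(B(x_0,\delta))]}{\mu[B(0,1)]}\Big)^{1/d},\qquad F_\delta(x)=\frac{f(x_0+\delta x)-f(x_0)}{\rho_f(\delta)},$$ the infinitesimal space $T(x_0,f)$ is the set of all locally uniform limits on $\mathbb R^d$ of sequences $F_{\delta_k}$ with $\delta_k>0$, $\delta_k\to0$; $f$ is simple at $x_0$ if $T(x_0,f)$ has exactly one element. A fixed point $x_0$ of $f$, near which $f$ is injective, is attracting if the set of locally uniform limits on $\mathbb R^d$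 of $(f(x_0+t_kx)-f(x_0))/t_k$ over sequences $t_k>0$, $t_k\to0$, is non-empty and consists only of uniformly quasiconformal maps $\psi:\mathbb R^d\to\mathbb R^d$ that fix $0$ and $\infty$ and satisfy $\psi^m(x)\to0$ as $m\to\infty$ for all $x\in\mathbb R^d$. The radial map with profile $p$ is $x\mapsto p(|x|)\,x/|x|$ for $x\ne0$, $0\mapsto0$. *Statement.* There is a uniformly quasiconformal map $H:B^d\to B^d$ with an attracting fixed point at $0$ which is not simple at $0$; indeed $T(0,H)$ has more than one element. More precisely, let $K>1$, and for $n\in\mathbb Z$ put $$r_{2n}=2^{-(nK+n/K)},\quad r_{2n-1}=2^{-((n-1)K+n/K)},\quad k_{2n-1}=K,\quad k_{2n}=1/K.$$ Let $f:[0,1]\to[0,1]$ be given by $f(0)=0$ and $f(r)=2^{-n}r_n^{-k_n}r^{k_n}$ for $r\in[r_n,r_{n-1}]$, $n\ge1$. Then the radial map $F$ with profile $f$ is a quasiconformal map of $B^d$ onto $B^d$ with maximal distortion at most $K^{d-1}$. Let $H$ be the radial map whose profile $h:[0,1]\to[0,1]$ satisfies $f(h(r))=f(r)/2$, so that $F(H(x))=\tfrac12F(x)$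 on $B^d$. Then $H$ is a uniformly quasiconformal map of $B^d$ into itself, $0$ is an attracting fixed point of $H$, $H^m\to0$ uniformly on $B^d$ as $m\to\infty$, and $H$ is not simple at $0$: the maps $H(r_{2k}x)/\rho_H(r_{2k})$ and $H(r_{2k-1}x)/\rho_H(r_{2k-1})$ converge locally uniformly on $\mathbb R^d$ as $k\to\infty$ to the radial maps with profiles $Q_1$ and $Q_2$ respectively, where for all $m\in\mathbb Z$ $$Q_1(r)=\begin{cases} r_{2m}^{1-K^2}r^{K^2}, & r\in[r_{2m+1},r_{2m}],\\ r_{2m}^{1-1/K^2}r^{1/K^2}, & r\in[r_{2m},r_{2m-1}],\end{cases}$$ $$Q_2(r)=\begin{cases} r_{2m+2}^{1-K^2}r^{K^2}, & r\in[r_{2m+2},2^{-K+1/K}r_{2m+1}],\\ r_{2m}^{1-1/K^2}r^{1/K^2}, & r\in[2^{-K+1/K}r_{2m+1},r_{2m}],\end{cases}$$ and these two radial maps are distinct elements of $T(0,H)$. -/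

import Mathlib

open Set Filter Topology MeasureTheory
open scoped ContDiff ENNReal

noncomputable section

/-- Euclidean space `ℝ^d`. -/
abbrev Eucl (d : ℕ) : Type := EuclideanSpace ℝ (Fin d)

/-- The open unit ball `B^d`. -/
def unitBall (d : ℕ) : Set (Eucl d) := Metric.ball 0 1

/-! ### Quasiregular and quasiconformal mappings -/

/-- `g` is a weak (distributional) derivative of `f` on `U`: integration by parts holds against all
smooth test functions with compact support in `U`, in every direction `v`. -/
def IsWeakDerivOn {d : ℕ} (f : Eucl d → Eucl d) (g : Eucl d → (Eucl d →L[ℝ] Eucl d))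
    (U : Set (Eucl d)) : Prop :=
  ∀ φ : Eucl d → ℝ, ContDiff ℝ ∞ φ → HasCompactSupport φ → tsupport φ ⊆ U →
    ∀ v : Eucl d, ∫ x in U, (fderiv ℝ φ x v) • f x = - ∫ x in U, φ x • g x v

/-- `f` belongs to the Sobolev space `W^1_{d,loc}(U)`, with weak derivative `g`. -/
def IsSobolevLocOn {d : ℕ} (f : Eucl d → Eucl d) (g : Eucl d → (Eucl d →L[ℝ] Eucl d))
    (U : Set (Eucl d)) : Prop :=
  (∀ C : Set (Eucl d), IsCompact C → C ⊆ U →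
    MemLp f (d : ℝ≥0∞) (volume.restrict C) ∧ MemLp g (d : ℝ≥0∞) (volume.restrict C)) ∧
  IsWeakDerivOn f g U

/-- `f` is quasiregular on the domain `U` with maximal distortion at most `K`: it is continuous, lies
in `W^1_{d,loc}(U)`, and almost everywhere in `U` its weak derivative satisfies both
`|f'(x)|^d ≤ K J_f(x)` and `J_f(x) ≤ K inf_{|v| = 1} |f'(x) v|^d`. -/
def IsQuasiregularOn {d : ℕ} (K : ℝ) (f : Eucl d → Eucl d) (U : Set (Eucl d)) : Prop :=
  IsOpen U ∧ IsConnected U ∧ 1 ≤ K ∧ ContinuousOn f U ∧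
  ∃ g : Eucl d → (Eucl d →L[ℝ] Eucl d), IsSobolevLocOn f g U ∧
    ∀ᵐ x ∂(volume.restrict U),
      ‖g x‖ ^ d ≤ K * (g x).det ∧
      ∀ v : Eucl d, ‖v‖ = 1 → (g x).det ≤ K * ‖g x v‖ ^ d

/-- Quasiconformal mappings are the injective quasiregular mappings. -/
def IsQuasiconformalOn {d : ℕ} (K : ℝ) (f : Eucl d → Eucl d) (U : Set (Eucl d)) : Prop :=
  IsQuasiregularOn K f U ∧ InjOn f U

/-- `f` is a uniformly quasiconformal map of `U` into itself: the maximal distortions of all the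
iterates of `f` have a common bound. -/
def IsUniformlyQuasiconformalOn {d : ℕ} (f : Eucl d → Eucl d) (U : Set (Eucl d)) : Prop :=
  MapsTo f U U ∧ ∃ K : ℝ, ∀ n : ℕ, 1 ≤ n → IsQuasiconformalOn K (f^[n]) U

/-! ### The infinitesimal space

The notions below depend only on the germ of `f` at `x₀`, so `f` may be any total function that
extends a mapping defined near `x₀`. -/

/-- The mean radius `ρ_f(δ) = (μ(f(B(x₀, δ))) / μ(B(0, 1)))^{1/d}`. -/
def meanRadius {d : ℕ} (f : Eucl d → Eucl d) (x₀ : Eucl d) (δ : ℝ) : ℝ :=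
  ((volume (f '' Metric.ball x₀ δ)).toReal / (volume (Metric.ball (0 : Eucl d) 1)).toReal)
    ^ (1 / (d : ℝ))

/-- The rescaled map `F_δ(x) = (f(x₀ + δ x) - f(x₀)) / ρ_f(δ)`. -/
def rescaled {d : ℕ} (f : Eucl d → Eucl d) (x₀ : Eucl d) (δ : ℝ) : Eucl d → Eucl d :=
  fun x => (meanRadius f x₀ δ)⁻¹ • (f (x₀ + δ • x) - f x₀)

/-- The infinitesimal space `T(x₀, f)`: all locally uniform limits on `ℝ^d` of sequences `F_{δ_k}`
with `δ_k > 0`, `δ_k → 0`. -/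
def infinitesimalSpace {d : ℕ} (x₀ : Eucl d) (f : Eucl d → Eucl d) : Set (Eucl d → Eucl d) :=
  {ψ | ∃ δ : ℕ → ℝ, (∀ k, 0 < δ k) ∧ Tendsto δ atTop (𝓝 0) ∧
    TendstoLocallyUniformly (fun k => rescaled f x₀ (δ k)) ψ atTop}

/-- `f` is simple at `x₀` if `T(x₀, f)` consists of exactly one mapping. -/
def IsSimpleAt {d : ℕ} (f : Eucl d → Eucl d) (x₀ : Eucl d) : Prop :=
  ∃ ψ, infinitesimalSpace x₀ f = {ψ}

/-! ### Attracting fixed points -/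

/-- The set of locally uniform limits of `(f(x₀ + t_k x) - f(x₀)) / t_k` with `t_k > 0`, `t_k → 0`
(the infinitesimal space of Hinkkanen, Martin and Mayer). -/
def linearInfinitesimalSpace {d : ℕ} (x₀ : Eucl d) (f : Eucl d → Eucl d) :
    Set (Eucl d → Eucl d) :=
  {ψ | ∃ t : ℕ → ℝ, (∀ k, 0 < t k) ∧ Tendsto t atTop (𝓝 0) ∧
    TendstoLocallyUniformly (fun k x => (t k)⁻¹ • (f (x₀ + t k • x) - f x₀)) ψ atTop}

/-- `ψ : ℝ^d → ℝ^d` is loxodromically attracting: it fixes `0` and `∞`, and `ψ^m(x) → 0` for every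
`x ∈ ℝ^d`. -/
def IsLoxodromicallyAttracting {d : ℕ} (ψ : Eucl d → Eucl d) : Prop :=
  ψ 0 = 0 ∧ Tendsto ψ (cocompact (Eucl d)) (cocompact (Eucl d)) ∧
  ∀ x, Tendsto (fun m : ℕ => ψ^[m] x) atTop (𝓝 0)

/-- `x₀` is an attracting fixed point of `f`, in the sense of Hinkkanen, Martin and Mayer: `f` is
injective near `x₀` (local index one), and its (non-empty) linear infinitesimal space at `x₀` consists
only of loxodromically attracting uniformly quasiconformal mappings of `ℝ^d`. -/
def IsAttractingFixedPoint {d : ℕ} (f : Eucl d → Eucl d) (x₀ : Eucl d) : Prop :=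
  f x₀ = x₀ ∧ (∃ V ∈ 𝓝 x₀, InjOn f V) ∧ (linearInfinitesimalSpace x₀ f).Nonempty ∧
  ∀ ψ ∈ linearInfinitesimalSpace x₀ f,
    IsUniformlyQuasiconformalOn ψ univ ∧ IsLoxodromicallyAttracting ψ

/-! ### The radial construction -/

/-- The radial map with profile `p`, given in spherical coordinates by `(r, σ) ↦ (p(r), σ)`
and mapping `0` to `0`. -/
def radialMap {d : ℕ} (p : ℝ → ℝ) (x : Eucl d) : Eucl d := (p ‖x‖ / ‖x‖) • x

/-- The exponents `k_n`: `K` for odd `n`, and `1 / K` for even `n`. -/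
def expSeq (K : ℝ) (n : ℤ) : ℝ := if Odd n then K else 1 / K

/-- The radii `r_n`, for every integer `n`: `r_{2n} = 2^{-(nK + n/K)}` and
`r_{2n-1} = 2^{-((n-1)K + n/K)}` (integer division rounds down here). -/
def radius (K : ℝ) (n : ℤ) : ℝ :=
  (2 : ℝ) ^ (-(((n / 2 : ℤ) : ℝ) * K + (((n + 1) / 2 : ℤ) : ℝ) / K))

/-- `f` is on `[0, 1]` the profile with `f(0) = 0`, `f(r_n) = 2^{-n}` and `f(r) = C_n r^{k_n}` on
`[r_n, r_{n-1}]` for `n ≥ 1`; hence `C_n = 2^{-n} r_n^{-k_n}`. -/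
def IsZigzagProfile (K : ℝ) (f : ℝ → ℝ) : Prop :=
  f 0 = 0 ∧ ∀ n : ℕ, 1 ≤ n → ∀ r ∈ Icc (radius K n) (radius K (n - 1)),
    f r = (1 / 2 : ℝ) ^ n * radius K n ^ (-expSeq K n) * r ^ expSeq K n

/-- The profile of the first limit map, on `(0, ∞)`. -/
def IsFirstLimitProfile (K : ℝ) (Q : ℝ → ℝ) : Prop :=
  ∀ m : ℤ,
    (∀ r ∈ Icc (radius K (2 * m + 1)) (radius K (2 * m)),
      Q r = radius K (2 * m) ^ (1 - K ^ 2) * r ^ (K ^ 2)) ∧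
    (∀ r ∈ Icc (radius K (2 * m)) (radius K (2 * m - 1)),
      Q r = radius K (2 * m) ^ (1 - 1 / K ^ 2) * r ^ (1 / K ^ 2))

/-- The profile of the second limit map, on `(0, ∞)`. -/
def IsSecondLimitProfile (K : ℝ) (Q : ℝ → ℝ) : Prop :=
  ∀ m : ℤ,
    (∀ r ∈ Icc (radius K (2 * m + 2)) ((2 : ℝ) ^ (-K + 1 / K) * radius K (2 * m + 1)),
      Q r = radius K (2 * m + 2) ^ (1 - K ^ 2) * r ^ (K ^ 2)) ∧
    (∀ r ∈ Icc ((2 : ℝ) ^ (-K + 1 / K) * radius K (2 * m + 1)) (radius K (2 * m)),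
      Q r = radius K (2 * m) ^ (1 - 1 / K ^ 2) * r ^ (1 / K ^ 2))

end

noncomputable section

/-! In the coordinate `s = log₂ r`, radial maps become functions of one real variable, composition
stays composition, and dilations become translations. The profile of `F` becomes `zigzag K`, a
function `L` with slopes `1/K` and `K` satisfying `L (s + P) = L s + 2` for `P = K + 1/K`. The map
`H` becomes `s ↦ L⁻¹ (L s - 1)`.

The `n`-th iterate of `H` is then `s ↦ L⁻¹ (L s - n)`, whose slopes lie between `1/K²` and `K²` for
every `n` (`iterate_conjShift`, `SlopePinched.conjShift`). A radial map whose logarithmic slopes lie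
in `[1/κ, κ]` is quasiconformal with distortion at most `κ^(d-1)` (`isQuasiconformalOn_radialMap`):
its derivative stretches by `p/r` tangentially and by `p'` radially, and the ratio of the two lies
in `[1/κ, κ]`. Such a map need not be Lipschitz at the origin, so the weak derivative is obtained by
truncating the profile and passing to the limit.

Rescaling `H` linearly only moves the base point `a` of `conjShift`, which matters only modulo `P`.
By compactness every linear limit is again a conjugated translation, hence uniformly quasiconformal
and contracting (`exists_eq_of_mem_linearInfinitesimalSpace`). With the mean-radius normalization,
the rescalings along the even radii are all one map and those along the odd radii all another. The
two differ because the kinks of `L` at even and odd radii bend in opposite directions. -/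

/-- The positive profile `p` grows at least like `r ^ (1 / κ)` and at most like `r ^ κ` between any
two radii. -/
structure PowerPinched (κ : ℝ) (p : ℝ → ℝ) : Prop where
  zero : p 0 = 0
  pos : ∀ r, 0 < r → 0 < p r
  lower : ∀ r s, 0 < r → r ≤ s → (s / r) ^ (1 / κ) * p r ≤ p s
  upper : ∀ r s, 0 < r → r ≤ s → p s ≤ (s / r) ^ κ * p r

/-! ### Pinched profiles: monotonicity, difference bounds and truncation. -/

namespace PowerPinched

variable {κ : ℝ} {p : ℝ → ℝ}

theorem nonneg (hp : PowerPinched κ p) {r : ℝ} (hr : 0 ≤ r) : 0 ≤ p r := by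
  rcases hr.eq_or_lt with rfl | h
  · exact hp.zero.ge
  · exact (hp.pos r h).le

theorem lt (hp : PowerPinched κ p) (hκ : 1 ≤ κ) {r s : ℝ} (hr : 0 ≤ r) (hrs : r < s) :
    p r < p s := by
  rcases hr.eq_or_lt with rfl | h
  · rw [hp.zero]; exact hp.pos s hrs
  · refine lt_of_lt_of_le ?_ (hp.lower r s h hrs.le)
    have h1 : 1 < (s / r) ^ (1 / κ) :=
      Real.one_lt_rpow ((one_lt_div h).2 hrs) (by positivity)
    nlinarith [hp.pos r h]

theorem mono (hp : PowerPinched κ p) (hκ : 1 ≤ κ) {r s : ℝ} (hr : 0 ≤ r) (hrs : r ≤ s) :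
    p r ≤ p s := by
  rcases hrs.eq_or_lt with rfl | h
  · exact le_rfl
  · exact (hp.lt hκ hr h).le

/-- Bernoulli's inequality applied to `p r ≥ (r / s) ^ κ * p s`. It makes `p` Lipschitz wherever `p
s / s` is bounded. -/
theorem sub_le (hp : PowerPinched κ p) (hκ : 1 ≤ κ) {r s : ℝ} (hr : 0 ≤ r) (hrs : r ≤ s)
    (hs : 0 < s) : p s - p r ≤ κ * (p s / s) * (s - r) := by
  rcases hr.eq_or_lt with rfl | h
  · rw [hp.zero]
    have := hp.pos s hs
    have e : κ * (p s / s) * (s - 0) = κ * p s := by field_simp; simp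
    rw [e]; nlinarith
  · have h1 := one_add_mul_self_le_rpow_one_add (s := r / s - 1) (p := κ)
      (by have : 0 < r / s := by positivity
          linarith) hκ
    rw [add_sub_cancel] at h1
    have h2 := hp.upper r s h hrs
    have h3 : (r / s) ^ κ * p s ≤ p r := by
      calc (r / s) ^ κ * p s ≤ (r / s) ^ κ * ((s / r) ^ κ * p r) := by gcongr
        _ = p r := by
          rw [← mul_assoc, ← Real.mul_rpow (by positivity) (by positivity)]
          have : r / s * (s / r) = 1 := by field_simp
          rw [this, Real.one_rpow, one_mul]
    have h4 := mul_le_mul_of_nonneg_right h1 (hp.pos s hs).le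
    have e : κ * (p s / s) * (s - r) = - (κ * (r / s - 1)) * p s := by field_simp; ring
    rw [e]; linarith

/-- A linear profile has exponent one, which lies between `1/κ` and `κ`, and a minimum inherits both
growth bounds. These truncations remove the possible failure of the Lipschitz property at the
origin. -/
theorem min_linear (hp : PowerPinched κ p) (hκ : 1 ≤ κ) {c : ℝ} (hc : 0 < c) :
    PowerPinched κ (fun r => min (p r) (c * r)) where
  zero := by simp [hp.zero]
  pos r hr := lt_min (hp.pos r hr) (by positivity)
  lower r s hr hrs := by
    have h1 : 1 ≤ s / r := (one_le_div hr).2 hrs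
    have hs : 0 < s := hr.trans_le hrs
    have h0 : 0 < s / r := by positivity
    rw [le_min_iff]
    constructor
    · refine le_trans ?_ (hp.lower r s hr hrs)
      gcongr
      exact min_le_left _ _
    · have h2 : (s / r) ^ (1 / κ) ≤ s / r := by
        conv_rhs => rw [← Real.rpow_one (s / r)]
        exact Real.rpow_le_rpow_of_exponent_le h1 ((div_le_one (by linarith)).2 hκ)
      calc (s / r) ^ (1 / κ) * min (p r) (c * r) ≤ (s / r) * (c * r) := by
            gcongr
            · exact le_min (hp.pos r hr).le (by positivity)
            · exact min_le_right _ _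
        _ = c * s := by field_simp
  upper r s hr hrs := by
    have h1 : 1 ≤ s / r := (one_le_div hr).2 hrs
    have hs : 0 < s := hr.trans_le hrs
    have h0 : 0 < s / r := by positivity
    have h2 : s / r ≤ (s / r) ^ κ := by
      conv_lhs => rw [← Real.rpow_one (s / r)]
      exact Real.rpow_le_rpow_of_exponent_le h1 hκ
    rw [mul_min_of_nonneg _ _ (by positivity)]
    refine min_le_min (hp.upper r s hr hrs) ?_
    calc c * s = (s / r) * (c * r) := by field_simp
      _ ≤ _ := by gcongr

end PowerPinched

/-! ### Radial maps: norm, injectivity and Lipschitz bound. -/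

theorem norm_radialMap {d : ℕ} {p : ℝ → ℝ} (h0 : p 0 = 0) (hp : ∀ r, 0 < r → 0 < p r)
    (x : Eucl d) : ‖radialMap p x‖ = p ‖x‖ := by
  rcases eq_or_ne x 0 with rfl | hx
  · simp [radialMap, h0]
  · have hx' : 0 < ‖x‖ := norm_pos_iff.2 hx
    rw [radialMap, norm_smul, Real.norm_of_nonneg (div_pos (hp _ hx') hx').le,
      div_mul_cancel₀ _ hx'.ne']

theorem PowerPinched.norm_radialMap {d : ℕ} {κ : ℝ} {p : ℝ → ℝ} (hp : PowerPinched κ p)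
    (x : Eucl d) : ‖radialMap p x‖ = p ‖x‖ :=
  _root_.norm_radialMap hp.zero hp.pos x

@[simp] theorem radialMap_zero {d : ℕ} (p : ℝ → ℝ) : radialMap p (0 : Eucl d) = 0 := by
  simp [radialMap]

theorem PowerPinched.injective_radialMap {d : ℕ} {κ : ℝ} {p : ℝ → ℝ} (hp : PowerPinched κ p)
    (hκ : 1 ≤ κ) : Function.Injective (radialMap p : Eucl d → Eucl d) := by
  intro x y hxy
  have hn : ‖x‖ = ‖y‖ := by
    have h := congrArg norm hxy
    rw [hp.norm_radialMap, hp.norm_radialMap] at h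
    rcases lt_trichotomy ‖x‖ ‖y‖ with h' | h' | h'
    · exact absurd h (hp.lt hκ (norm_nonneg _) h').ne
    · exact h'
    · exact absurd h (hp.lt hκ (norm_nonneg _) h').ne'
  rcases eq_or_ne x 0 with rfl | hx
  · rw [norm_zero] at hn; exact (norm_eq_zero.1 hn.symm).symm
  · have hx' : 0 < ‖x‖ := norm_pos_iff.2 hx
    simp only [radialMap, ← hn] at hxy
    exact smul_right_injective _ (div_pos (hp.pos _ hx') hx').ne' hxy

theorem PowerPinched.lipschitzWith_radialMap {d : ℕ} {κ c : ℝ} {p : ℝ → ℝ} (hp : PowerPinched κ p)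
    (hκ : 1 ≤ κ) (hc : 0 ≤ c) (hpc : ∀ r, 0 < r → p r ≤ c * r) :
    LipschitzWith (Real.toNNReal (3 * (κ * c))) (radialMap p : Eucl d → Eucl d) := by
  have hκc : c ≤ κ * c := le_mul_of_one_le_left hc hκ
  have hlip : ∀ r s : ℝ, 0 ≤ r → r ≤ s → 0 < s → p s - p r ≤ κ * c * (s - r) := by
    intro r s hr hrs hs
    refine (hp.sub_le hκ hr hrs hs).trans ?_
    have h1 : p s / s ≤ c := (div_le_iff₀ hs).2 (hpc s hs)
    have := sub_nonneg.2 hrs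
    gcongr
  have key : ∀ x y : Eucl d, ‖x‖ ≤ ‖y‖ →
      ‖radialMap p x - radialMap p y‖ ≤ 3 * (κ * c) * ‖x - y‖ := by
    intro x y hxy
    rcases eq_or_ne y 0 with rfl | hy
    · have : x = 0 := by simpa using hxy
      subst this; simp
    have hy' : 0 < ‖y‖ := norm_pos_iff.2 hy
    have hd : ‖y‖ - ‖x‖ ≤ ‖x - y‖ := by
      rw [norm_sub_rev]; exact norm_sub_norm_le y x
    have h2 : p ‖y‖ - p ‖x‖ ≤ κ * c * ‖x - y‖ :=
      (hlip _ _ (norm_nonneg _) hxy hy').trans (by gcongr)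
    have h3 := hp.mono hκ (norm_nonneg _) hxy
    rcases eq_or_ne x 0 with rfl | hx
    · rw [radialMap_zero, zero_sub, norm_neg, hp.norm_radialMap]
      rw [norm_zero, hp.zero] at h2
      have : 0 ≤ κ * c * ‖0 - y‖ := by positivity
      linarith
    have hx' : 0 < ‖x‖ := norm_pos_iff.2 hx
    -- Compare at radius `‖x‖` first: `x` against the radial projection of `y` to that sphere, then
    -- move along the ray of `y`. Three terms of size at most `κ * c * ‖x - y‖` arise, whence the
    -- factor 3.
    have e : radialMap p x - radialMap p y =
        (p ‖x‖ / ‖x‖) • ((x - y) + (1 - ‖x‖ / ‖y‖) • y) - ((p ‖y‖ - p ‖x‖) / ‖y‖) • y := by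
      simp only [radialMap, smul_add, smul_sub, smul_smul]
      have : p ‖x‖ / ‖x‖ * (1 - ‖x‖ / ‖y‖) = p ‖x‖ / ‖x‖ - p ‖x‖ / ‖y‖ := by
        field_simp
      rw [this, sub_div]
      module
    have h4 : ‖(1 - ‖x‖ / ‖y‖) • y‖ ≤ ‖x - y‖ := by
      rw [norm_smul, Real.norm_of_nonneg (sub_nonneg.2 ((div_le_one hy').2 hxy)), sub_mul,
        div_mul_cancel₀ _ hy'.ne', one_mul]
      exact hd
    have h5 : ‖((p ‖y‖ - p ‖x‖) / ‖y‖) • y‖ ≤ κ * c * ‖x - y‖ := by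
      rw [norm_smul, Real.norm_of_nonneg (div_nonneg (sub_nonneg.2 h3) hy'.le),
        div_mul_cancel₀ _ hy'.ne']
      exact h2
    have h6 : ‖p ‖x‖ / ‖x‖‖ ≤ κ * c := by
      rw [Real.norm_of_nonneg (div_pos (hp.pos _ hx') hx').le]
      exact ((div_le_iff₀ hx').2 (hpc _ hx')).trans hκc
    rw [e]
    calc _ ≤ ‖p ‖x‖ / ‖x‖‖ * (‖x - y‖ + ‖(1 - ‖x‖ / ‖y‖) • y‖) +
          ‖((p ‖y‖ - p ‖x‖) / ‖y‖) • y‖ := by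
          refine (norm_sub_le _ _).trans ?_
          rw [norm_smul]
          gcongr
          exact norm_add_le _ _
      _ ≤ κ * c * (‖x - y‖ + ‖x - y‖) + κ * c * ‖x - y‖ := by gcongr
      _ = _ := by ring
  refine LipschitzWith.of_dist_le_mul fun x y => ?_
  rw [Real.coe_toNNReal _ (by positivity), dist_eq_norm, dist_eq_norm]
  rcases le_total ‖x‖ ‖y‖ with h | h
  · exact key x y h
  · rw [norm_sub_rev, norm_sub_rev x y]; exact key y x h

/-! ### The derivative of a radial map -/

/-- The derivative of the radial map with profile `p` at `x`, if `p` has derivative `p'` at `‖x‖`. -/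
def radialDeriv {d : ℕ} (p : ℝ → ℝ) (p' : ℝ) (x : Eucl d) : Eucl d →L[ℝ] Eucl d :=
  (p ‖x‖ / ‖x‖) • ContinuousLinearMap.id ℝ (Eucl d) +
    ((p' - p ‖x‖ / ‖x‖) / ‖x‖ ^ 2) • (innerSL ℝ x).smulRight x

theorem radialDeriv_apply {d : ℕ} (p : ℝ → ℝ) (p' : ℝ) (x v : Eucl d) :
    radialDeriv p p' x v = (p ‖x‖ / ‖x‖) • v +
      ((p' - p ‖x‖ / ‖x‖) / ‖x‖ ^ 2 * inner ℝ x v) • x := by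
  simp [radialDeriv, smul_smul]

theorem hasFDerivAt_radialMap {d : ℕ} {p : ℝ → ℝ} {p' : ℝ} {x : Eucl d} (hx : x ≠ 0)
    (hp : HasDerivAt p p' ‖x‖) : HasFDerivAt (radialMap p) (radialDeriv p p' x) x := by
  have hx' : ‖x‖ ≠ 0 := norm_ne_zero_iff.2 hx
  have hn : HasFDerivAt (fun y : Eucl d => ‖y‖) (‖x‖⁻¹ • innerSL ℝ x) x := by
    have h1 := (hasStrictFDerivAt_norm_sq x).hasFDerivAt.sqrt (by positivity)
    have h2 : (fun y : Eucl d => √(‖y‖ ^ 2)) = fun y => ‖y‖ := by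
      ext y; exact Real.sqrt_sq (norm_nonneg _)
    rw [h2, Real.sqrt_sq (norm_nonneg _)] at h1
    refine h1.congr_fderiv ?_
    ext v
    simp
    field_simp
  have hq : HasDerivAt (fun r => p r / r) ((p' * ‖x‖ - p ‖x‖ * 1) / ‖x‖ ^ 2) ‖x‖ :=
    hp.div (hasDerivAt_id _) hx'
  have h := (hq.comp_hasFDerivAt x hn).smul (hasFDerivAt_id x)
  refine h.congr_fderiv ?_
  ext1 v
  rw [radialDeriv_apply]
  simp [smul_smul]
  congr 1
  field_simp

/-- Pythagoras: the component of `v` orthogonal to `x` is scaled by `p ‖x‖ / ‖x‖`, the component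
along `x` by `p'`. -/
theorem norm_sq_radialDeriv_apply {d : ℕ} (p : ℝ → ℝ) (p' : ℝ) {x : Eucl d} (hx : x ≠ 0)
    (v : Eucl d) : ‖radialDeriv p p' x v‖ ^ 2 =
      (p ‖x‖ / ‖x‖) ^ 2 * (‖v‖ ^ 2 - (inner ℝ x v / ‖x‖) ^ 2) +
        p' ^ 2 * (inner ℝ x v / ‖x‖) ^ 2 := by
  have hx' : ‖x‖ ≠ 0 := norm_ne_zero_iff.2 hx
  rw [radialDeriv_apply, norm_add_sq_real, norm_smul, norm_smul, inner_smul_left, inner_smul_right,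
    real_inner_comm, mul_pow, mul_pow]
  simp only [Real.norm_eq_abs, sq_abs, conj_trivial]
  field_simp
  ring

/-- The derivative is a multiple of the identity plus a rank-one map, that is, a scaled
transvection, whose determinant is known. -/
theorem det_radialDeriv {d : ℕ} (p : ℝ → ℝ) (p' : ℝ) {x : Eucl d} (hx : x ≠ 0)
    (hd : 1 ≤ d) (hp : p ‖x‖ ≠ 0) :
    (radialDeriv p p' x).det = (p ‖x‖ / ‖x‖) ^ (d - 1) * p' := by
  have hx' : ‖x‖ ≠ 0 := norm_ne_zero_iff.2 hx
  have e : (radialDeriv p p' x : Eucl d →ₗ[ℝ] Eucl d) = (p ‖x‖ / ‖x‖) •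
      LinearMap.transvection (innerSL ℝ x : Eucl d →ₗ[ℝ] ℝ)
        (((p' - p ‖x‖ / ‖x‖) / ‖x‖ ^ 2 / (p ‖x‖ / ‖x‖)) • x) := by
    ext1 v
    simp only [ContinuousLinearMap.coe_coe, radialDeriv_apply, LinearMap.smul_apply,
      LinearMap.transvection.apply, smul_add, smul_smul, innerSL_apply_apply]
    congr 2
    field_simp
  rw [ContinuousLinearMap.det, e, LinearMap.det_smul, LinearMap.transvection.det]
  obtain ⟨k, rfl⟩ : ∃ k, d = k + 1 := ⟨d - 1, by omega⟩
  simp only [finrank_euclideanSpace_fin, Nat.add_sub_cancel, map_smul, ContinuousLinearMap.coe_coe,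
    innerSL_apply_apply, real_inner_self_eq_norm_sq, smul_eq_mul]
  rw [pow_succ]
  field_simp
  ring

theorem norm_radialDeriv_apply_le {d : ℕ} {p : ℝ → ℝ} {p' M : ℝ} {x : Eucl d} (hx : x ≠ 0)
    (h1 : |p ‖x‖ / ‖x‖| ≤ M) (h2 : |p'| ≤ M) (v : Eucl d) :
    ‖radialDeriv p p' x v‖ ≤ M * ‖v‖ := by
  have hM : 0 ≤ M := (abs_nonneg _).trans h2
  have hx' : 0 < ‖x‖ := norm_pos_iff.2 hx
  refine abs_le_of_sq_le_sq' ?_ (by positivity) |>.2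
  have hc : (inner ℝ x v / ‖x‖) ^ 2 ≤ ‖v‖ ^ 2 := by
    rw [← sq_abs, abs_div, abs_of_pos hx']
    have := abs_real_inner_le_norm x v
    have : |inner ℝ x v| / ‖x‖ ≤ ‖v‖ := by rw [div_le_iff₀ hx']; linarith
    gcongr
  rw [norm_sq_radialDeriv_apply p p' hx]
  have h3 : (p ‖x‖ / ‖x‖) ^ 2 ≤ M ^ 2 := sq_le_sq' (abs_le.1 h1).1 (abs_le.1 h1).2
  have h4 : p' ^ 2 ≤ M ^ 2 := sq_le_sq' (abs_le.1 h2).1 (abs_le.1 h2).2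
  have := sub_nonneg.2 hc
  nlinarith [sq_nonneg (inner ℝ x v / ‖x‖)]

theorem le_norm_radialDeriv_apply {d : ℕ} {p : ℝ → ℝ} {p' m : ℝ} {x : Eucl d} (hx : x ≠ 0)
    (hm : 0 ≤ m) (h1 : m ≤ p ‖x‖ / ‖x‖) (h2 : m ≤ p') (v : Eucl d) :
    m * ‖v‖ ≤ ‖radialDeriv p p' x v‖ := by
  have hx' : 0 < ‖x‖ := norm_pos_iff.2 hx
  refine abs_le_of_sq_le_sq' ?_ (by positivity) |>.2
  have hc : (inner ℝ x v / ‖x‖) ^ 2 ≤ ‖v‖ ^ 2 := by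
    rw [← sq_abs, abs_div, abs_of_pos hx']
    have := abs_real_inner_le_norm x v
    have : |inner ℝ x v| / ‖x‖ ≤ ‖v‖ := by rw [div_le_iff₀ hx']; linarith
    gcongr
  rw [norm_sq_radialDeriv_apply p p' hx]
  have h3 : m ^ 2 ≤ (p ‖x‖ / ‖x‖) ^ 2 := by gcongr
  have h4 : m ^ 2 ≤ p' ^ 2 := by gcongr
  have := sub_nonneg.2 hc
  nlinarith [sq_nonneg (inner ℝ x v / ‖x‖)]

/-- Restricting the map to the ray through `x` and projecting back onto `x` recovers `p`. This is
needed because Rademacher's theorem speaks of the map and not of the profile. -/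
theorem differentiableAt_profile {d : ℕ} {p : ℝ → ℝ} {x : Eucl d} (hx : x ≠ 0)
    (h : DifferentiableAt ℝ (radialMap p) x) : DifferentiableAt ℝ p ‖x‖ := by
  have hx' : 0 < ‖x‖ := norm_pos_iff.2 hx
  have hline : DifferentiableAt ℝ (fun t : ℝ => (t / ‖x‖) • x) ‖x‖ := by fun_prop
  have h1 : DifferentiableAt ℝ (fun t : ℝ => inner ℝ x (radialMap p ((t / ‖x‖) • x)) / ‖x‖) ‖x‖ := by
    have h' : DifferentiableAt ℝ (radialMap p) ((‖x‖ / ‖x‖) • x) := by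
      rwa [div_self hx'.ne', one_smul]
    have h2 : DifferentiableAt ℝ (fun t : ℝ => radialMap p ((t / ‖x‖) • x)) ‖x‖ :=
      DifferentiableAt.comp (g := (radialMap p : Eucl d → Eucl d)) ‖x‖ h' hline
    exact ((differentiableAt_const x).inner ℝ h2).div_const _
  refine h1.congr_of_eventuallyEq ?_
  filter_upwards [lt_mem_nhds hx'] with t ht
  have hnt : ‖(t / ‖x‖) • x‖ = t := by
    rw [norm_smul, Real.norm_of_nonneg (by positivity), div_mul_cancel₀ _ hx'.ne']
  rw [radialMap, hnt, smul_smul, inner_smul_right, real_inner_self_eq_norm_sq]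
  field_simp

/-- The growth bounds say that `p s * s ^ (-(1 / κ))` increases and `p s * s ^ (-κ)` decreases, so
their derivatives have a sign. -/
theorem PowerPinched.deriv_bounds {κ : ℝ} {p : ℝ → ℝ} (hp : PowerPinched κ p) {p' r : ℝ}
    (hr : 0 < r) (h : HasDerivAt p p' r) :
    1 / κ * (p r / r) ≤ p' ∧ p' ≤ κ * (p r / r) := by
  have key : ∀ a : ℝ, HasDerivAt (fun s => p s * s ^ (-a)) ((p' - a * (p r / r)) * r ^ (-a)) r := by
    intro a
    refine (h.mul (Real.hasDerivAt_rpow_const (p := -a) (Or.inl hr.ne'))).congr_deriv ?_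
    rw [Real.rpow_sub_one hr.ne']
    field_simp
    ring
  have hpos : ∀ a : ℝ, 0 < r ^ (-a) := fun a => Real.rpow_pos_of_pos hr _
  have hmul : ∀ (a u v : ℝ), 0 < u → 0 < v → (v / u) ^ a * u ^ a = v ^ a := by
    intro a u v hu hv
    rw [← Real.mul_rpow (by positivity) hu.le, div_mul_cancel₀ _ hu.ne']
  constructor
  · have hm : MonotoneOn (fun s => p s * s ^ (-(1 / κ))) (Ioi 0) := by
      intro u hu v hv huv
      rw [mem_Ioi] at hu hv
      have := hp.lower u v hu huv
      simp only [Real.rpow_neg hu.le, Real.rpow_neg hv.le, ← div_eq_mul_inv]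
      rw [div_le_div_iff₀ (Real.rpow_pos_of_pos hu _) (Real.rpow_pos_of_pos hv _),
        ← hmul _ u v hu hv]
      nlinarith [Real.rpow_pos_of_pos hu (1 / κ)]
    have h1 := hm.derivWithin_nonneg (x := r)
    rw [((key (1 / κ)).hasDerivWithinAt).derivWithin (isOpen_Ioi.uniqueDiffWithinAt hr)] at h1
    have := nonneg_of_mul_nonneg_left h1 (hpos _)
    linarith
  · have hm : AntitoneOn (fun s => p s * s ^ (-κ)) (Ioi 0) := by
      intro u hu v hv huv
      rw [mem_Ioi] at hu hv
      have := hp.upper u v hu huv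
      simp only [Real.rpow_neg hu.le, Real.rpow_neg hv.le, ← div_eq_mul_inv]
      rw [div_le_div_iff₀ (Real.rpow_pos_of_pos hv _) (Real.rpow_pos_of_pos hu _),
        ← hmul _ u v hu hv]
      nlinarith [Real.rpow_pos_of_pos hu κ]
    have h1 := hm.derivWithin_nonpos (x := r)
    rw [((key κ).hasDerivWithinAt).derivWithin (isOpen_Ioi.uniqueDiffWithinAt hr)] at h1
    have := nonpos_of_mul_nonpos_left h1 (hpos _)
    linarith

/-! ### Radial maps with pinched profile are quasiconformal -/

namespace PowerPinched

variable {d : ℕ} {κ : ℝ} {p : ℝ → ℝ}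

theorem fderiv_radialMap (hp : PowerPinched κ p) {x : Eucl d} (hx : x ≠ 0)
    (h : DifferentiableAt ℝ (radialMap p) x) :
    ∃ p', fderiv ℝ (radialMap p) x = radialDeriv p p' x ∧
      1 / κ * (p ‖x‖ / ‖x‖) ≤ p' ∧ p' ≤ κ * (p ‖x‖ / ‖x‖) := by
  have hd := (differentiableAt_profile hx h).hasDerivAt
  exact ⟨_, (hasFDerivAt_radialMap hx hd).fderiv, hp.deriv_bounds (norm_pos_iff.2 hx) hd⟩

theorem norm_fderiv_radialMap_le (hp : PowerPinched κ p) (hκ : 1 ≤ κ) {x : Eucl d} (hx : x ≠ 0)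
    (h : DifferentiableAt ℝ (radialMap p) x) :
    ‖fderiv ℝ (radialMap p) x‖ ≤ κ * (p ‖x‖ / ‖x‖) := by
  obtain ⟨p', e, h1, h2⟩ := hp.fderiv_radialMap hx h
  have hx' := norm_pos_iff.2 hx
  have hq : 0 < p ‖x‖ / ‖x‖ := div_pos (hp.pos _ hx') hx'
  rw [e]
  refine ContinuousLinearMap.opNorm_le_bound _ (by positivity) fun v => ?_
  refine norm_radialDeriv_apply_le hx ?_ ?_ v
  · rw [abs_of_pos hq]; nlinarith
  · rwa [abs_of_nonneg (le_trans (by positivity) h1)]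

theorem le_norm_fderiv_radialMap (hp : PowerPinched κ p) (hκ : 1 ≤ κ) {x : Eucl d} (hx : x ≠ 0)
    (h : DifferentiableAt ℝ (radialMap p) x) :
    p ‖x‖ / ‖x‖ ≤ κ * ‖fderiv ℝ (radialMap p) x‖ := by
  obtain ⟨p', e, h1, h2⟩ := hp.fderiv_radialMap hx h
  have hx' := norm_pos_iff.2 hx
  have hq : 0 < p ‖x‖ / ‖x‖ := div_pos (hp.pos _ hx') hx'
  have hκ0 : 0 < κ := by linarith
  rw [e]
  have h3 := le_norm_radialDeriv_apply (p := p) hx (by positivity)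
    (mul_le_of_le_one_left hq.le ((div_le_one hκ0).2 hκ)) h1 x
  have h4 := le_of_mul_le_mul_right (h3.trans ((radialDeriv p p' x).le_opNorm x)) hx'
  calc p ‖x‖ / ‖x‖ = κ * (1 / κ * (p ‖x‖ / ‖x‖)) := by field_simp
    _ ≤ _ := by gcongr

/-- With `q = p ‖x‖ / ‖x‖` the Jacobian is `q ^ (d - 1) * p'`, and `q`, `p'` differ by a factor of
at most `κ`. The full power `κ ^ (d - 1)` is spent when `p'` is the larger in the first inequality
or the smaller in the second; otherwise one factor `κ` is enough. -/
theorem distortion (hp : PowerPinched κ p) (hκ : 1 ≤ κ) (hd : 2 ≤ d) {x : Eucl d} (hx : x ≠ 0)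
    (h : DifferentiableAt ℝ (radialMap p) x) :
    ‖fderiv ℝ (radialMap p) x‖ ^ d ≤ κ ^ (d - 1) * (fderiv ℝ (radialMap p) x).det ∧
    ∀ v : Eucl d, ‖v‖ = 1 →
      (fderiv ℝ (radialMap p) x).det ≤ κ ^ (d - 1) * ‖fderiv ℝ (radialMap p) x v‖ ^ d := by
  obtain ⟨p', e, h1, h2⟩ := hp.fderiv_radialMap hx h
  have hx' := norm_pos_iff.2 hx
  have hpx := hp.pos _ hx'
  have hκ0 : 0 < κ := by linarith
  rw [e, det_radialDeriv p p' hx (by omega) hpx.ne']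
  obtain ⟨k, rfl⟩ : ∃ k, d = k + 2 := ⟨d - 2, by omega⟩
  have hq : 0 < p ‖x‖ / ‖x‖ := div_pos hpx hx'
  have A : ∀ v, ∀ M, p ‖x‖ / ‖x‖ ≤ M → p' ≤ M → ‖radialDeriv p p' x v‖ ≤ M * ‖v‖ := by
    intro v M hM hM'
    refine norm_radialDeriv_apply_le hx ?_ ?_ v
    · rwa [abs_of_pos hq]
    · rwa [abs_of_nonneg (le_trans (by positivity) h1)]
  have B : ∀ v, ∀ m, 0 ≤ m → m ≤ p ‖x‖ / ‖x‖ → m ≤ p' → m * ‖v‖ ≤ ‖radialDeriv p p' x v‖ :=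
    fun v m hm hm1 hm2 => le_norm_radialDeriv_apply hx hm hm1 hm2 v
  set q := p ‖x‖ / ‖x‖
  have hp' : 0 < p' := lt_of_lt_of_le (by positivity) h1
  have h1' : q ≤ κ * p' := by
    calc q = κ * (1 / κ * q) := by field_simp
      _ ≤ _ := by gcongr
  have hκk : κ ≤ κ ^ (k + 1) := le_self_pow₀ hκ (by omega)
  simp only [show k + 2 - 1 = k + 1 from rfl]
  constructor
  · have hmax : ‖radialDeriv p p' x‖ ≤ max q p' :=
      ContinuousLinearMap.opNorm_le_bound _ (by positivity) fun v =>
        A v _ (le_max_left _ _) (le_max_right _ _)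
    refine (pow_le_pow_left₀ (norm_nonneg _) hmax _).trans ?_
    rcases le_total q p' with hle | hle
    · rw [max_eq_right hle]
      calc p' ^ (k + 2) = p' ^ (k + 1) * p' := by ring
        _ ≤ (κ * q) ^ (k + 1) * p' := by gcongr
        _ = _ := by ring
    · rw [max_eq_left hle]
      calc q ^ (k + 2) = q ^ (k + 1) * q := by ring
        _ ≤ q ^ (k + 1) * (κ ^ (k + 1) * p') := by
          gcongr
          exact h1'.trans (by gcongr)
        _ = _ := by ring
  · intro v hv
    have hmin := B v (min q p') (by positivity) (min_le_left _ _) (min_le_right _ _)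
    rw [hv, mul_one] at hmin
    refine le_trans ?_ (mul_le_mul_of_nonneg_left (pow_le_pow_left₀ (by positivity) hmin (k + 2))
      (by positivity))
    rcases le_total q p' with hle | hle
    · rw [min_eq_left hle]
      calc q ^ (k + 1) * p' ≤ q ^ (k + 1) * (κ ^ (k + 1) * q) := by
            gcongr
            exact h2.trans (by gcongr)
        _ = _ := by ring
    · rw [min_eq_right hle]
      calc q ^ (k + 1) * p' ≤ (κ * p') ^ (k + 1) * p' := by gcongr
        _ = _ := by ring

/-- On the shell between radii `‖x‖ / 2` and `2 * ‖x‖` the quotient `p r / r` is bounded, so the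
truncation is inactive there once `n` is large. -/
theorem eventually_radialMap_min_linear_eq (hp : PowerPinched κ p) (hκ : 1 ≤ κ) {x : Eucl d}
    (hx : x ≠ 0) :
    ∀ᶠ n : ℕ in atTop, radialMap (fun r => min (p r) (((n : ℝ) + 1) * r)) =ᶠ[𝓝 x] radialMap p := by
  have hx' := norm_pos_iff.2 hx
  obtain ⟨N, hN⟩ := exists_nat_ge (p (2 * ‖x‖) / (‖x‖ / 2))
  filter_upwards [eventually_ge_atTop N] with n hn
  have h1 : ∀ᶠ y : Eucl d in 𝓝 x, ‖x‖ / 2 < ‖y‖ :=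
    continuous_norm.continuousAt.eventually (lt_mem_nhds (by linarith))
  have h2 : ∀ᶠ y : Eucl d in 𝓝 x, ‖y‖ < 2 * ‖x‖ :=
    continuous_norm.continuousAt.eventually (gt_mem_nhds (by linarith))
  filter_upwards [h1, h2] with y hy1 hy2
  have hn' : (N : ℝ) ≤ n := by exact_mod_cast hn
  have : p ‖y‖ ≤ ((n : ℝ) + 1) * ‖y‖ := by
    calc p ‖y‖ ≤ p (2 * ‖x‖) := hp.mono hκ (norm_nonneg _) hy2.le
      _ = p (2 * ‖x‖) / (‖x‖ / 2) * (‖x‖ / 2) := by field_simp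
      _ ≤ ((n : ℝ) + 1) * ‖y‖ := by
        gcongr
        linarith
  rw [radialMap, radialMap, min_eq_left this]

theorem lipschitzWith_radialMap_min_linear (hp : PowerPinched κ p) (hκ : 1 ≤ κ) (n : ℕ) :
    LipschitzWith (Real.toNNReal (3 * (κ * ((n : ℝ) + 1))))
      (radialMap (fun r => min (p r) (((n : ℝ) + 1) * r)) : Eucl d → Eucl d) :=
  (hp.min_linear hκ (by positivity)).lipschitzWith_radialMap hκ (by positivity)
    fun _ _ => min_le_right _ _

/-- Away from the origin the map agrees locally with a Lipschitz truncation; at the origin `p r ≤ r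
^ (1 / κ) * p 1` for `r ≤ 1`. -/
theorem continuous_radialMap (hp : PowerPinched κ p) (hκ : 1 ≤ κ) :
    Continuous (radialMap p : Eucl d → Eucl d) := by
  rw [continuous_iff_continuousAt]
  intro x
  rcases eq_or_ne x 0 with rfl | hx
  · rw [ContinuousAt, radialMap_zero, tendsto_zero_iff_norm_tendsto_zero]
    simp only [hp.norm_radialMap]
    have h1 : Tendsto (fun y : Eucl d => ‖y‖ ^ (1 / κ) * p 1) (𝓝 0) (𝓝 0) := by
      have : Continuous fun y : Eucl d => ‖y‖ ^ (1 / κ) * p 1 :=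
        (continuous_norm.rpow_const fun _ => Or.inr (by positivity)).mul_const _
      have h := this.tendsto 0
      rwa [norm_zero, Real.zero_rpow (by positivity), zero_mul] at h
    refine squeeze_zero' (.of_forall fun y => hp.nonneg (norm_nonneg y)) ?_ h1
    have h2 : ∀ᶠ y : Eucl d in 𝓝 0, ‖y‖ < 1 :=
      continuous_norm.continuousAt.eventually (gt_mem_nhds (by simp))
    filter_upwards [h2] with y hy
    rcases eq_or_ne y 0 with rfl | hy0
    · rw [norm_zero, hp.zero, Real.zero_rpow (by positivity), zero_mul]
    · have hy' := norm_pos_iff.2 hy0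
      have h3 := hp.lower _ _ hy' hy.le
      calc p ‖y‖ = ‖y‖ ^ (1 / κ) * ((1 / ‖y‖) ^ (1 / κ) * p ‖y‖) := by
            rw [← mul_assoc, ← Real.mul_rpow (by positivity) (by positivity),
              mul_one_div_cancel hy'.ne', Real.one_rpow, one_mul]
        _ ≤ _ := by gcongr
  · obtain ⟨n, hn⟩ := (hp.eventually_radialMap_min_linear_eq hκ hx).exists
    exact (hp.lipschitzWith_radialMap_min_linear hκ n).continuous.continuousAt.congr hn

theorem ae_differentiableAt_min_linear (hp : PowerPinched κ p) (hκ : 1 ≤ κ) (hd : 1 ≤ d) :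
    ∀ᵐ x : Eucl d, x ≠ 0 ∧ ∀ n : ℕ,
      DifferentiableAt ℝ (radialMap (fun r => min (p r) (((n : ℝ) + 1) * r))) x := by
  have : Nonempty (Fin d) := ⟨⟨0, hd⟩⟩
  have h0 : ∀ᵐ x : Eucl d, x ≠ 0 := by
    simp [ae_iff]
  filter_upwards [h0, ae_all_iff.2 fun n : ℕ =>
    (hp.lipschitzWith_radialMap_min_linear (d := d) hκ n).ae_differentiableAt] with x h1 h2
  exact ⟨h1, h2⟩

/-- The index of the truncation that agrees with the map depends on `x`, so one null set has to
serve all the truncations at once. -/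
theorem ae_differentiableAt (hp : PowerPinched κ p) (hκ : 1 ≤ κ) (hd : 1 ≤ d) :
    ∀ᵐ x : Eucl d, x ≠ 0 ∧ DifferentiableAt ℝ (radialMap p) x := by
  filter_upwards [hp.ae_differentiableAt_min_linear hκ hd] with x ⟨hx, h⟩
  obtain ⟨n, hn⟩ := (hp.eventually_radialMap_min_linear_eq hκ hx).exists
  exact ⟨hx, (h n).congr_of_eventuallyEq hn.symm⟩

/-- By the distortion inequality the `d`-th power of the norm is dominated by the Jacobian, and the
Jacobian of an injective map integrates to the volume of the image, which is finite for compact `C`.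
-/
theorem memLp_fderiv_radialMap (hp : PowerPinched κ p) (hκ : 1 ≤ κ) (hd : 2 ≤ d) {C : Set (Eucl d)}
    (hC : IsCompact C) :
    MemLp (fderiv ℝ (radialMap p)) (d : ℝ≥0∞) (volume.restrict C) := by
  have hmeas : Measurable (fderiv ℝ (radialMap p : Eucl d → Eucl d)) := measurable_fderiv ℝ _
  refine ⟨hmeas.aestronglyMeasurable, ?_⟩
  rw [eLpNorm_lt_top_iff_lintegral_rpow_enorm_lt_top (by simp; omega) (by simp)]
  set S : Set (Eucl d) := {x | x ≠ 0 ∧ DifferentiableAt ℝ (radialMap p) x} with hS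
  have hSm : MeasurableSet S :=
    (measurableSet_singleton (0 : Eucl d)).compl.inter (measurableSet_of_differentiableAt ℝ _)
  have hae : (C ∩ S : Set (Eucl d)) =ᵐ[volume] C := by
    have := hp.ae_differentiableAt (d := d) hκ (by omega)
    filter_upwards [this] with x hx
    exact propext ⟨fun h => h.1, fun h => ⟨h, hx⟩⟩
  rw [← setLIntegral_congr hae]
  have hCS : MeasurableSet (C ∩ S) := hC.measurableSet.inter hSm
  have hbound : ∫⁻ x in C ∩ S, ‖fderiv ℝ (radialMap p) x‖ₑ ^ (d : ℝ≥0∞).toReal ≤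
      ∫⁻ x in C ∩ S, ENNReal.ofReal (κ ^ (d - 1)) *
        ENNReal.ofReal |(fderiv ℝ (radialMap p) x).det| := by
    refine setLIntegral_mono' hCS fun x hx => ?_
    have h1 := (hp.distortion hκ hd hx.2.1 hx.2.2).1
    rw [ENNReal.toReal_natCast, ENNReal.rpow_natCast, ← ofReal_norm,
      ← ENNReal.ofReal_pow (norm_nonneg _), ← ENNReal.ofReal_mul (by positivity)]
    exact ENNReal.ofReal_le_ofReal (h1.trans (by gcongr; exact le_abs_self _))
  refine hbound.trans_lt ?_
  rw [lintegral_const_mul' _ _ ENNReal.ofReal_ne_top]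
  refine ENNReal.mul_lt_top ENNReal.ofReal_lt_top ?_
  rw [lintegral_abs_det_fderiv_eq_addHaar_image volume hCS
    (fun x hx => hx.2.2.hasFDerivAt.hasFDerivWithinAt) (hp.injective_radialMap hκ).injOn]
  exact (measure_mono (image_mono inter_subset_left)).trans_lt
    (hC.image (hp.continuous_radialMap hκ)).measure_lt_top

end PowerPinched

/-! ### Weak derivatives by integration by parts. -/

/-- Integration by parts of a Lipschitz map against a smooth compactly supported function. -/
theorem LipschitzWith.integral_fderiv_smul_eq {d : ℕ} {C : NNReal} {F : Eucl d → Eucl d}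
    (hF : LipschitzWith C F) {φ : Eucl d → ℝ} (hφ : ContDiff ℝ ∞ φ) (hc : HasCompactSupport φ)
    (v : Eucl d) :
    ∫ x, (fderiv ℝ φ x v) • F x = - ∫ x, φ x • fderiv ℝ F x v := by
  have hφ1 : ContDiff ℝ 1 φ := hφ.of_le (by simp)
  obtain ⟨D, hD⟩ := hφ1.lipschitzWith_of_hasCompactSupport hc (by simp)
  have hdcont : Continuous (fun x => fderiv ℝ φ x v) :=
    (hφ1.continuous_fderiv (by simp)).clm_apply continuous_const
  have hdc : HasCompactSupport (fun x => fderiv ℝ φ x v) :=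
    (hc.fderiv ℝ).comp_left (g := fun L : Eucl d →L[ℝ] ℝ => L v) (by simp)
  have I1 : Integrable (fun x => (fderiv ℝ φ x v) • F x) :=
    (hdcont.smul hF.continuous).integrable_of_hasCompactSupport hdc.smul_right
  have hmeas : Measurable (fun x => fderiv ℝ F x v) := measurable_fderiv_apply_const ℝ F v
  have I2 : Integrable (fun x => φ x • fderiv ℝ F x v) := by
    refine Integrable.mono' (g := fun x => ‖φ x‖ * (C * ‖v‖))
      ((hφ.continuous.norm.mul_const _).integrable_of_hasCompactSupport hc.norm.mul_right)
      (hφ.continuous.aestronglyMeasurable.smul hmeas.aestronglyMeasurable) (.of_forall fun x => ?_)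
    rw [norm_smul]
    gcongr
    exact ((fderiv ℝ F x).le_opNorm v).trans (by gcongr; exact norm_fderiv_le_of_lipschitz ℝ hF)
  rw [← integral_neg]
  -- Reduce to coordinates, where the scalar integration by parts for Lipschitz functions applies.
  ext i
  let π : Eucl d →L[ℝ] ℝ := EuclideanSpace.proj i
  have hπ : LipschitzWith (‖π‖₊ * C) (fun x => π (F x)) := π.lipschitz.comp hF
  have key := hπ.integral_lineDeriv_mul_eq (μ := volume) hD hc v
  have e1 : (∫ x, (fderiv ℝ φ x v) • F x) i = ∫ x, fderiv ℝ φ x v * π (F x) := by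
    have := π.integral_comp_comm I1
    simp only [map_smul, smul_eq_mul] at this
    exact this.symm
  have e2 : (∫ x, -(φ x • fderiv ℝ F x v)) i = ∫ x, -(φ x * π (fderiv ℝ F x v)) := by
    have := π.integral_comp_comm I2.neg
    simp only [Pi.neg_apply, map_neg, map_smul, smul_eq_mul] at this
    exact this.symm
  rw [e1, e2, integral_neg]
  have e3 : ∫ x, lineDeriv ℝ (fun x => π (F x)) x v * φ x = ∫ x, φ x * π (fderiv ℝ F x v) := by
    refine integral_congr_ae ?_
    filter_upwards [hF.ae_differentiableAt] with x hx
    have : HasFDerivAt (fun x => π (F x)) (π.comp (fderiv ℝ F x)) x :=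
      π.hasFDerivAt.comp x hx.hasFDerivAt
    rw [(this.hasLineDerivAt v).lineDeriv, mul_comm]
    rfl
  have e4 : ∫ x, lineDeriv ℝ φ x (-v) * π (F x) = - ∫ x, fderiv ℝ φ x v * π (F x) := by
    rw [← integral_neg]
    refine integral_congr_ae (.of_forall fun x => ?_)
    have := (hφ1.differentiable (by simp) x).hasFDerivAt
    simp only [(this.hasLineDerivAt (-v)).lineDeriv, map_neg, neg_mul]
  rw [e3, e4] at key
  rw [key, neg_neg]

namespace PowerPinched

variable {d : ℕ} {κ : ℝ} {p : ℝ → ℝ}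

theorem integrable_smul_fderiv (hp : PowerPinched κ p) (hκ : 1 ≤ κ) (hd : 2 ≤ d)
    {φ : Eucl d → ℝ} (hφ : Continuous φ) (hc : HasCompactSupport φ) :
    Integrable (fun x => φ x • fderiv ℝ (radialMap p : Eucl d → Eucl d) x) := by
  have h1 : LocallyIntegrable (fderiv ℝ (radialMap p : Eucl d → Eucl d)) := by
    refine locallyIntegrable_iff.2 fun C hC => ?_
    have : IsFiniteMeasure (volume.restrict C) :=
      isFiniteMeasure_restrict.2 hC.measure_lt_top.ne
    exact (hp.memLp_fderiv_radialMap hκ hd hC).integrable (by exact_mod_cast (by omega : 1 ≤ d))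
  exact h1.integrable_smul_left_of_hasCompactSupport hφ hc

theorem norm_fderiv_min_linear_le (hp : PowerPinched κ p) (hκ : 1 ≤ κ) (n : ℕ) {x : Eucl d}
    (hx : x ≠ 0) (h : DifferentiableAt ℝ (radialMap p) x)
    (hn : DifferentiableAt ℝ (radialMap (fun r => min (p r) (((n : ℝ) + 1) * r))) x) :
    ‖fderiv ℝ (radialMap (fun r => min (p r) (((n : ℝ) + 1) * r))) x‖ ≤
      κ ^ 2 * ‖fderiv ℝ (radialMap p) x‖ := by
  have h1 := (hp.min_linear hκ (by positivity : (0 : ℝ) < n + 1)).norm_fderiv_radialMap_le hκ hx hn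
  have h2 := hp.le_norm_fderiv_radialMap hκ hx h
  calc _ ≤ κ * (min (p ‖x‖) (((n : ℝ) + 1) * ‖x‖) / ‖x‖) := h1
    _ ≤ κ * (p ‖x‖ / ‖x‖) := by
      gcongr
      exact min_le_left _ _
    _ ≤ κ * (κ * ‖fderiv ℝ (radialMap p) x‖) := by gcongr
    _ = _ := by ring

/-- Dominated convergence from the Lipschitz truncations. Their derivatives are dominated by that of
the map itself, since both are comparable to quotients profile over radius and truncation only
lowers the profile. -/
theorem integral_fderiv_smul_eq (hp : PowerPinched κ p) (hκ : 1 ≤ κ) (hd : 2 ≤ d)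
    {φ : Eucl d → ℝ} (hφ : ContDiff ℝ ∞ φ) (hc : HasCompactSupport φ) (v : Eucl d) :
    ∫ x, (fderiv ℝ φ x v) • radialMap p x = - ∫ x, φ x • fderiv ℝ (radialMap p) x v := by
  let P : ℕ → ℝ → ℝ := fun n r => min (p r) (((n : ℝ) + 1) * r)
  have hP : ∀ n, PowerPinched κ (P n) := fun n => hp.min_linear hκ (by positivity)
  have hL : ∀ n : ℕ, LipschitzWith (Real.toNNReal (3 * (κ * ((n : ℝ) + 1))))
    (radialMap (P n) : Eucl d → Eucl d) := hp.lipschitzWith_radialMap_min_linear hκ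
  have hdcont : Continuous (fun x => fderiv ℝ φ x v) :=
    (hφ.continuous_fderiv (by simp)).clm_apply continuous_const
  have hdc : HasCompactSupport (fun x => fderiv ℝ φ x v) :=
    (hc.fderiv ℝ).comp_left (g := fun L : Eucl d →L[ℝ] ℝ => L v) (by simp)
  have hcont := hp.continuous_radialMap (d := d) hκ
  have T1 : Tendsto (fun n => ∫ x, (fderiv ℝ φ x v) • radialMap (P n) x) atTop
      (𝓝 (∫ x, (fderiv ℝ φ x v) • radialMap p x)) := by
    refine tendsto_integral_of_dominated_convergence
      (fun x => ‖(fderiv ℝ φ x v) • radialMap p x‖)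
      (fun n => (hdcont.smul (hL n).continuous).aestronglyMeasurable)
      ((hdcont.smul hcont).integrable_of_hasCompactSupport hdc.smul_right).norm
      (fun n => .of_forall fun x => ?_) (.of_forall fun x => ?_)
    · rw [norm_smul, norm_smul, hp.norm_radialMap, (hP n).norm_radialMap]
      gcongr
      exact min_le_left _ _
    · refine tendsto_const_nhds.congr' ?_
      rcases eq_or_ne x 0 with rfl | hx
      · simp
      · filter_upwards [hp.eventually_radialMap_min_linear_eq hκ hx] with n hn
        rw [hn.eq_of_nhds]
  have T2 : Tendsto (fun n => ∫ x, φ x • fderiv ℝ (radialMap (P n)) x v) atTop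
      (𝓝 (∫ x, φ x • fderiv ℝ (radialMap p) x v)) := by
    have hint := hp.integrable_smul_fderiv hκ hd hφ.continuous hc
    refine tendsto_integral_of_dominated_convergence
      (fun x => κ ^ 2 * ‖v‖ * ‖φ x • fderiv ℝ (radialMap p) x‖)
      (fun n => hφ.continuous.aestronglyMeasurable.smul
        (measurable_fderiv_apply_const ℝ _ v).aestronglyMeasurable)
      (hint.norm.const_mul _) (fun n => ?_) ?_
    · filter_upwards [hp.ae_differentiableAt hκ (by omega),
        hp.ae_differentiableAt_min_linear hκ (by omega)] with x hx hx'
      have h3 : ‖fderiv ℝ (radialMap (P n)) x‖ ≤ κ ^ 2 * ‖fderiv ℝ (radialMap p) x‖ :=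
        hp.norm_fderiv_min_linear_le hκ n hx.1 hx.2 (hx'.2 n)
      rw [norm_smul, norm_smul]
      calc _ ≤ ‖φ x‖ * (‖fderiv ℝ (radialMap (P n)) x‖ * ‖v‖) := by
            gcongr
            exact ContinuousLinearMap.le_opNorm _ _
        _ ≤ ‖φ x‖ * ((κ ^ 2 * ‖fderiv ℝ (radialMap p) x‖) * ‖v‖) := by gcongr
        _ = _ := by ring
    · filter_upwards [hp.ae_differentiableAt hκ (by omega)] with x hx
      refine tendsto_const_nhds.congr' ?_
      filter_upwards [hp.eventually_radialMap_min_linear_eq hκ hx.1] with n hn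
      rw [hn.fderiv_eq]
  exact tendsto_nhds_unique (T1.congr fun n => (hL n).integral_fderiv_smul_eq hφ hc v) T2.neg

/-- A radial map with pinched profile is quasiconformal on every domain. -/
theorem isQuasiconformalOn_radialMap (hp : PowerPinched κ p) (hκ : 1 ≤ κ) (hd : 2 ≤ d)
    {U : Set (Eucl d)} (hU : IsOpen U) (hU' : IsConnected U) :
    IsQuasiconformalOn (κ ^ (d - 1)) (radialMap p) U := by
  have hcont := hp.continuous_radialMap (d := d) hκ
  refine ⟨⟨hU, hU', one_le_pow₀ hκ, hcont.continuousOn,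
    fderiv ℝ (radialMap p), ⟨fun C hC _ => ⟨?_, hp.memLp_fderiv_radialMap hκ hd hC⟩, ?_⟩, ?_⟩,
    (hp.injective_radialMap hκ).injOn⟩
  · have : IsFiniteMeasure (volume.restrict C) :=
      isFiniteMeasure_restrict.2 hC.measure_lt_top.ne
    obtain ⟨M, hM⟩ := hC.exists_bound_of_continuousOn hcont.continuousOn
    exact MemLp.of_bound hcont.aestronglyMeasurable M
      ((ae_restrict_iff' hC.measurableSet).2 (.of_forall hM))
  · intro φ hφ hc hs v
    have h0 : ∀ x ∉ U, φ x = 0 := fun x hx => image_eq_zero_of_notMem_tsupport fun h => hx (hs h)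
    have h0' : ∀ x ∉ U, fderiv ℝ φ x = 0 := fun x hx =>
      image_eq_zero_of_notMem_tsupport fun h => hx (hs (tsupport_fderiv_subset ℝ h))
    rw [setIntegral_eq_integral_of_forall_compl_eq_zero fun x hx => by simp [h0' x hx],
      setIntegral_eq_integral_of_forall_compl_eq_zero fun x hx => by simp [h0 x hx]]
    exact hp.integral_fderiv_smul_eq hκ hd hφ hc v
  · filter_upwards [ae_restrict_of_ae (hp.ae_differentiableAt hκ (by omega))] with x hx
    exact hp.distortion hκ hd hx.1 hx.2

end PowerPinched

/-! ### Profiles in logarithmic coordinates -/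

/-- The profile that in the coordinate `log₂ r` is given by `φ`. -/
def expProfile (φ : ℝ → ℝ) (r : ℝ) : ℝ := if r ≤ 0 then 0 else (2 : ℝ) ^ φ (Real.logb 2 r)

theorem expProfile_zero (φ : ℝ → ℝ) : expProfile φ 0 = 0 := by simp [expProfile]

theorem expProfile_of_pos (φ : ℝ → ℝ) {r : ℝ} (hr : 0 < r) :
    expProfile φ r = (2 : ℝ) ^ φ (Real.logb 2 r) := by simp [expProfile, hr]

theorem expProfile_two_rpow (φ : ℝ → ℝ) (s : ℝ) : expProfile φ (2 ^ s) = 2 ^ φ s := by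
  rw [expProfile_of_pos _ (by positivity), Real.logb_rpow (by norm_num) (by norm_num)]

theorem two_rpow_logb {r : ℝ} (hr : 0 < r) : (2 : ℝ) ^ Real.logb 2 r = r :=
  Real.rpow_logb (by norm_num) (by norm_num) hr

theorem expProfile_pos (φ : ℝ → ℝ) (r : ℝ) (hr : 0 < r) : 0 < expProfile φ r := by
  rw [expProfile_of_pos _ hr]; positivity

theorem expProfile_comp (φ ψ : ℝ → ℝ) (r : ℝ) :
    expProfile φ (expProfile ψ r) = expProfile (φ ∘ ψ) r := by
  rcases le_or_gt r 0 with h | h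
  · simp [expProfile, h]
  · rw [expProfile_of_pos ψ h, expProfile_two_rpow, expProfile_of_pos _ h]
    rfl

theorem exists_two_rpow_eq {u v r : ℝ} (hr : r ∈ Icc ((2 : ℝ) ^ u) (2 ^ v)) :
    ∃ s ∈ Icc u v, r = 2 ^ s := by
  have hr0 : 0 < r := lt_of_lt_of_le (by positivity) hr.1
  refine ⟨Real.logb 2 r, ⟨?_, ?_⟩, (two_rpow_logb hr0).symm⟩
  · exact (Real.le_logb_iff_rpow_le (by norm_num) hr0).2 hr.1
  · exact (Real.logb_le_iff_le_rpow (by norm_num) hr0).2 hr.2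

theorem norm_radialMap_expProfile {d : ℕ} (φ : ℝ → ℝ) (x : Eucl d) :
    ‖radialMap (expProfile φ) x‖ = expProfile φ ‖x‖ :=
  norm_radialMap (expProfile_zero φ) (expProfile_pos φ) x

theorem radialMap_expProfile_comp {d : ℕ} (φ ψ : ℝ → ℝ) (x : Eucl d) :
    radialMap (expProfile φ) (radialMap (expProfile ψ) x) = radialMap (expProfile (φ ∘ ψ)) x := by
  rcases eq_or_ne x 0 with rfl | hx
  · simp
  have hx' := norm_pos_iff.2 hx
  have := expProfile_pos ψ _ hx'
  rw [radialMap, norm_radialMap_expProfile, expProfile_comp, radialMap, radialMap, smul_smul]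
  congr 1
  field_simp

theorem radialMap_expProfile_id {d : ℕ} (x : Eucl d) : radialMap (expProfile id) x = x := by
  rcases eq_or_ne x 0 with rfl | hx
  · simp
  have hx' := norm_pos_iff.2 hx
  rw [radialMap, expProfile_of_pos _ hx', id, two_rpow_logb hx', div_self hx'.ne', one_smul]

theorem radialMap_expProfile_iterate {d : ℕ} (φ : ℝ → ℝ) (n : ℕ) :
    (radialMap (expProfile φ) : Eucl d → Eucl d)^[n] = radialMap (expProfile φ^[n]) := by
  induction n with
  | zero => ext1 x; exact (radialMap_expProfile_id x).symm
  | succ n ih =>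
    ext1 x
    rw [Function.iterate_succ_apply', ih, radialMap_expProfile_comp, Function.iterate_succ']

/-- Dilating source and target translates the argument and the value in logarithmic coordinates. -/
theorem smul_radialMap_expProfile_smul {d : ℕ} (φ : ℝ → ℝ) (a b : ℝ) (x : Eucl d) :
    ((2 : ℝ) ^ b)⁻¹ • radialMap (expProfile φ) ((2 : ℝ) ^ a • x) =
      radialMap (expProfile fun s => φ (s + a) - b) x := by
  rcases eq_or_ne x 0 with rfl | hx
  · simp
  have hx' := norm_pos_iff.2 hx
  have ha : (0 : ℝ) < 2 ^ a := by positivity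
  have hb : (0 : ℝ) < 2 ^ b := by positivity
  rw [radialMap, radialMap, norm_smul, Real.norm_of_nonneg ha.le, expProfile_of_pos _ hx',
    expProfile_of_pos _ (by positivity), Real.logb_mul ha.ne' hx'.ne',
    Real.logb_rpow (by norm_num) (by norm_num), smul_smul, smul_smul, add_comm a,
    Real.rpow_sub (by norm_num)]
  congr 1
  field_simp

/-- All difference quotients of `φ` lie between `1 / κ` and `κ`. -/
def SlopePinched (κ : ℝ) (φ : ℝ → ℝ) : Prop :=
  ∀ s t, s ≤ t → (t - s) / κ ≤ φ t - φ s ∧ φ t - φ s ≤ κ * (t - s)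

namespace SlopePinched

variable {κ : ℝ} {φ ψ : ℝ → ℝ}

theorem powerPinched (h : SlopePinched κ φ) : PowerPinched κ (expProfile φ) where
  zero := expProfile_zero φ
  pos := expProfile_pos φ
  lower r s hr hrs := by
    have hs := hr.trans_le hrs
    rw [← two_rpow_logb hr, ← two_rpow_logb hs, expProfile_two_rpow, expProfile_two_rpow,
      ← Real.rpow_sub (by norm_num), ← Real.rpow_mul (by norm_num), ← Real.rpow_add (by norm_num)]
    refine Real.rpow_le_rpow_of_exponent_le (by norm_num) ?_
    have := (h _ _ (Real.logb_le_logb_of_le (b := 2) (by norm_num) hr hrs)).1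
    rw [mul_one_div]; linarith
  upper r s hr hrs := by
    have hs := hr.trans_le hrs
    rw [← two_rpow_logb hr, ← two_rpow_logb hs, expProfile_two_rpow, expProfile_two_rpow,
      ← Real.rpow_sub (by norm_num), ← Real.rpow_mul (by norm_num), ← Real.rpow_add (by norm_num)]
    refine Real.rpow_le_rpow_of_exponent_le (by norm_num) ?_
    have := (h _ _ (Real.logb_le_logb_of_le (b := 2) (by norm_num) hr hrs)).2
    linarith

theorem strictMono (h : SlopePinched κ φ) (hκ : 1 ≤ κ) : StrictMono φ := by
  intro s t hst
  have h1 := (h s t hst.le).1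
  have : 0 < (t - s) / κ := div_pos (sub_pos.2 hst) (by linarith)
  linarith

theorem continuous (h : SlopePinched κ φ) (hκ : 1 ≤ κ) : Continuous φ := by
  refine (LipschitzWith.of_le_add_mul (Real.toNNReal κ) fun s t => ?_).continuous
  rw [Real.coe_toNNReal _ (by linarith), Real.dist_eq]
  rcases le_total s t with hst | hst
  · have := (h.strictMono hκ).monotone hst
    have : 0 ≤ κ * |s - t| := by positivity
    linarith
  · have := (h t s hst).2
    rw [abs_of_nonneg (sub_nonneg.2 hst)]
    linarith

theorem surjective (h : SlopePinched κ φ) (hκ : 1 ≤ κ) : Function.Surjective φ := by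
  have hκ0 : 0 < κ := by linarith
  refine (h.continuous hκ).surjective ?_ ?_
  · refine tendsto_atTop_mono' _ ?_
      (tendsto_atTop_add_const_right atTop (φ 0) (tendsto_id.atTop_div_const hκ0))
    filter_upwards [eventually_ge_atTop 0] with t ht
    have := (h 0 t ht).1
    simp only [id, sub_zero] at *
    linarith
  · refine tendsto_atBot_mono' _ ?_
      (tendsto_atBot_add_const_right atBot (φ 0) (tendsto_id.atBot_div_const hκ0))
    filter_upwards [eventually_le_atBot 0] with t ht
    have := (h t 0 ht).1
    simp only [id, zero_sub, neg_div] at *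
    linarith

/-- The pinching condition is symmetric under exchanging argument and value. -/
theorem rightInverse (h : SlopePinched κ φ) (hκ : 1 ≤ κ) (hψ : ∀ y, φ (ψ y) = y) :
    SlopePinched κ ψ := by
  intro s t hst
  have hm : ψ s ≤ ψ t := by
    rw [← (h.strictMono hκ).le_iff_le, hψ, hψ]; exact hst
  have h1 := h _ _ hm
  rw [hψ, hψ] at h1
  have hκ0 : 0 < κ := by linarith
  rw [div_le_iff₀ hκ0] at h1 ⊢
  constructor <;> linarith

theorem comp {κ' : ℝ} (h : SlopePinched κ φ) (hκ : 1 ≤ κ) (h' : SlopePinched κ' ψ)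
    (hκ' : 1 ≤ κ') : SlopePinched (κ * κ') (φ ∘ ψ) := by
  intro s t hst
  have h1 := h' s t hst
  have h2 := h _ _ ((h'.strictMono hκ').monotone hst)
  simp only [Function.comp]
  have hκ0 : 0 < κ := by linarith
  constructor
  · refine le_trans ?_ h2.1
    rw [mul_comm, ← div_div]
    gcongr
    exact h1.1
  · refine h2.2.trans ?_
    rw [mul_assoc]
    gcongr
    exact h1.2

theorem shift (h : SlopePinched κ φ) (a b : ℝ) : SlopePinched κ (fun s => φ (s + a) - b) := by
  intro s t hst
  have := h (s + a) (t + a) (by linarith)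
  simp only [add_sub_add_right_eq_sub] at this
  constructor <;> linarith

theorem image_ball {d : ℕ} (h : SlopePinched κ φ) (hκ : 1 ≤ κ) {δ : ℝ} (hδ : 0 < δ) :
    (radialMap (expProfile φ) : Eucl d → Eucl d) '' Metric.ball 0 δ =
      Metric.ball 0 (expProfile φ δ) := by
  have hp := h.powerPinched
  have hlt : ∀ r, 0 ≤ r → (expProfile φ r < expProfile φ δ ↔ r < δ) := fun r hr =>
    ⟨fun hlt => lt_of_not_ge fun hge => hlt.not_ge (hp.mono hκ hδ.le hge), fun hr' => hp.lt hκ hr hr'⟩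
  ext y
  constructor
  · rintro ⟨x, hx, rfl⟩
    rw [mem_ball_zero_iff] at hx ⊢
    rw [norm_radialMap_expProfile, hlt _ (norm_nonneg _)]
    exact hx
  · intro hy
    obtain ⟨ψ, hψ⟩ := (h.surjective hκ).hasRightInverse
    have e : radialMap (expProfile φ) (radialMap (expProfile ψ) y) = y := by
      rw [radialMap_expProfile_comp, hψ.comp_eq_id, radialMap_expProfile_id]
    refine ⟨radialMap (expProfile ψ) y, ?_, e⟩
    rw [mem_ball_zero_iff] at hy ⊢
    rw [← hlt _ (norm_nonneg _), ← norm_radialMap_expProfile, e]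
    exact hy

/-- The image of a centred ball is a centred ball, so the mean radius is its actual radius. -/
theorem meanRadius_eq {d : ℕ} (hd : 1 ≤ d) (h : SlopePinched κ φ) (hκ : 1 ≤ κ) (a : ℝ) :
    meanRadius (radialMap (expProfile φ) : Eucl d → Eucl d) 0 (2 ^ a) = 2 ^ φ a := by
  have : Nonempty (Fin d) := ⟨⟨0, hd⟩⟩
  have hb : (0 : ℝ) < 2 ^ φ a := by positivity
  have hv : (volume (Metric.ball (0 : Eucl d) 1)).toReal ≠ 0 :=
    (ENNReal.toReal_pos (Metric.measure_ball_pos volume _ one_pos).ne'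
      measure_ball_lt_top.ne).ne'
  rw [meanRadius, h.image_ball hκ (by positivity), expProfile_two_rpow,
    Measure.addHaar_ball_of_pos volume 0 hb, ENNReal.toReal_mul,
    ENNReal.toReal_ofReal (by positivity), mul_div_cancel_right₀ _ hv, finrank_euclideanSpace_fin,
    one_div, Real.pow_rpow_inv_natCast hb.le (by omega)]

theorem rescaled_eq {d : ℕ} (hd : 1 ≤ d) (h : SlopePinched κ φ) (hκ : 1 ≤ κ) (a : ℝ) :
    rescaled (radialMap (expProfile φ) : Eucl d → Eucl d) 0 (2 ^ a) =
      radialMap (expProfile fun s => φ (s + a) - φ a) := by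
  ext1 x
  rw [rescaled, h.meanRadius_eq hd hκ, radialMap_zero, sub_zero, zero_add,
    smul_radialMap_expProfile_smul]

end SlopePinched

/-! ### Conjugates of translations -/

/-- The map `s ↦ L⁻¹ (L (s + a) - y) - a`, where `M` is the inverse of `L`. -/
def conjShift (L M : ℝ → ℝ) (a y s : ℝ) : ℝ := M (L (s + a) - y) - a

section conjShift

variable {κ : ℝ} {L M : ℝ → ℝ}

theorem SlopePinched.conjShift (h : SlopePinched κ L) (hκ : 1 ≤ κ) (hM : ∀ y, L (M y) = y)
    (a y : ℝ) : SlopePinched (κ * κ) (conjShift L M a y) := by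
  have h1 := ((h.rightInverse hκ hM).shift (-y) a).comp hκ (h.shift a 0) hκ
  have e : _root_.conjShift L M a y = (fun s => M (s + -y) - a) ∘ fun s => L (s + a) - 0 := by
    ext s; simp [_root_.conjShift, sub_eq_add_neg]
  rwa [e]

/-- Iterating a conjugated translation only multiplies the translation length, which does not enter
the pinching constant `κ * κ`. This is the source of uniform quasiconformality. -/
theorem iterate_conjShift (h : SlopePinched κ L) (hκ : 1 ≤ κ) (hM : ∀ y, L (M y) = y) (a y : ℝ)
    (n : ℕ) : (conjShift L M a y)^[n] = conjShift L M a (n * y) := by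
  induction n with
  | zero =>
    ext s
    have : M (L (s + a)) = s + a := (h.strictMono hκ).injective (hM _)
    simp [conjShift, this]
  | succ n ih =>
    ext s
    rw [Function.iterate_succ_apply', ih]
    simp only [conjShift, sub_add_cancel, hM]
    push_cast
    ring_nf

/-- `M` inverts `L` and has slopes at least `1 / κ`, so lowering its argument by `y` lowers its
value by at least `y / κ`. -/
theorem conjShift_le (h : SlopePinched κ L) (hκ : 1 ≤ κ) (hM : ∀ y, L (M y) = y) (a s : ℝ) {y : ℝ}
    (hy : 0 ≤ y) : conjShift L M a y s ≤ s - y / κ := by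
  have h1 : M (L (s + a)) = s + a := (h.strictMono hκ).injective (hM _)
  have h2 := ((h.rightInverse hκ hM) (L (s + a) - y) (L (s + a)) (by linarith)).1
  rw [h1, sub_sub_cancel] at h2
  rw [conjShift]
  linarith

/-- The map given by `conjShift` in logarithmic coordinates is uniformly quasiconformal. -/
theorem isUniformlyQuasiconformalOn_conjShift {d : ℕ} (hd : 2 ≤ d) (h : SlopePinched κ L)
    (hκ : 1 ≤ κ) (hM : ∀ y, L (M y) = y) (a y : ℝ) {U : Set (Eucl d)} (hU : IsOpen U)
    (hU' : IsConnected U) (hmaps : MapsTo (radialMap (expProfile (conjShift L M a y))) U U) :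
    IsUniformlyQuasiconformalOn (radialMap (expProfile (conjShift L M a y))) U := by
  refine ⟨hmaps, (κ * κ) ^ (d - 1), fun n _ => ?_⟩
  rw [radialMap_expProfile_iterate, iterate_conjShift h hκ hM]
  exact (h.conjShift hκ hM _ _).powerPinched.isQuasiconformalOn_radialMap (by nlinarith) hd hU hU'

theorem norm_iterate_conjShift_le {d : ℕ} (h : SlopePinched κ L) (hκ : 1 ≤ κ)
    (hM : ∀ y, L (M y) = y) (a : ℝ) (n : ℕ) (x : Eucl d) :
    ‖(radialMap (expProfile (conjShift L M a 1)))^[n] x‖ ≤ ((2 : ℝ) ^ (-(1 / κ))) ^ n * ‖x‖ := by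
  rw [radialMap_expProfile_iterate, norm_radialMap_expProfile, iterate_conjShift h hκ hM]
  rcases eq_or_ne x 0 with rfl | hx
  · simp [expProfile_zero]
  have hx' := norm_pos_iff.2 hx
  rw [expProfile_of_pos _ hx', ← Real.rpow_natCast, ← Real.rpow_mul (by norm_num)]
  nth_rw 2 [← two_rpow_logb hx']
  rw [← Real.rpow_add (by norm_num)]
  refine Real.rpow_le_rpow_of_exponent_le (by norm_num) ?_
  have := conjShift_le h hκ hM a (Real.logb 2 ‖x‖) (y := n * 1) (by positivity)
  have e : -(1 / κ) * n + Real.logb 2 ‖x‖ = Real.logb 2 ‖x‖ - n * 1 / κ := by ring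
  linarith

theorem two_rpow_neg_one_div_pow_tendsto (hκ : 1 ≤ κ) :
    Tendsto (fun n : ℕ => ((2 : ℝ) ^ (-(1 / κ))) ^ n) atTop (𝓝 0) :=
  tendsto_pow_atTop_nhds_zero_of_lt_one (by positivity)
    (Real.rpow_lt_one_of_one_lt_of_neg (by norm_num) (by have : 0 < 1 / κ := by positivity
                                                         linarith))

theorem isLoxodromicallyAttracting_conjShift {d : ℕ} (h : SlopePinched κ L) (hκ : 1 ≤ κ)
    (hM : ∀ y, L (M y) = y) (a : ℝ) :
    IsLoxodromicallyAttracting (radialMap (expProfile (conjShift L M a 1)) : Eucl d → Eucl d) := by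
  have hκ0 : 0 < κ := by linarith
  refine ⟨radialMap_zero _, ?_, fun x => ?_⟩
  · rw [← Metric.cobounded_eq_cocompact, ← tendsto_norm_atTop_iff_cobounded]
    have hp := (h.conjShift hκ hM a 1).powerPinched
    simp only [hp.norm_radialMap]
    have h1 : Tendsto (fun r : ℝ => r ^ (1 / (κ * κ)) * expProfile (conjShift L M a 1) 1)
        atTop atTop :=
      (tendsto_rpow_atTop (by positivity)).atTop_mul_const (expProfile_pos _ _ one_pos)
    refine Tendsto.comp (g := expProfile (conjShift L M a 1)) (tendsto_atTop_mono' _ ?_ h1)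
      (tendsto_norm_cobounded_atTop (E := Eucl d))
    filter_upwards [eventually_ge_atTop 1] with r hr
    simpa using hp.lower 1 r one_pos hr
  · refine squeeze_zero_norm (norm_iterate_conjShift_le h hκ hM a · x) ?_
    simpa using (two_rpow_neg_one_div_pow_tendsto hκ).mul_const ‖x‖

theorem tendstoUniformlyOn_iterate_conjShift {d : ℕ} (h : SlopePinched κ L) (hκ : 1 ≤ κ)
    (hM : ∀ y, L (M y) = y) (a : ℝ) :
    TendstoUniformlyOn
      (fun m : ℕ => (radialMap (expProfile (conjShift L M a 1)) : Eucl d → Eucl d)^[m])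
      (fun _ => 0) atTop (unitBall d) := by
  rw [Metric.tendstoUniformlyOn_iff]
  intro ε hε
  filter_upwards [(two_rpow_neg_one_div_pow_tendsto hκ).eventually (gt_mem_nhds hε)] with n hn x hx
  rw [dist_zero_left]
  refine (norm_iterate_conjShift_le h hκ hM a n x).trans_lt (lt_of_le_of_lt ?_ hn)
  exact mul_le_of_le_one_right (by positivity) (mem_ball_zero_iff.1 hx).le

theorem mapsTo_unitBall_conjShift {d : ℕ} (h : SlopePinched κ L) (hκ : 1 ≤ κ)
    (hM : ∀ y, L (M y) = y) (a : ℝ) :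
    MapsTo (radialMap (expProfile (conjShift L M a 1)) : Eucl d → Eucl d)
      (unitBall d) (unitBall d) := by
  intro x hx
  rw [unitBall, mem_ball_zero_iff] at hx ⊢
  refine lt_of_le_of_lt ?_ hx
  have h1 := norm_iterate_conjShift_le h hκ hM a 1 x
  rw [Function.iterate_one, pow_one] at h1
  refine h1.trans (mul_le_of_le_one_left (norm_nonneg _) ?_)
  exact Real.rpow_le_one_of_one_le_of_nonpos (by norm_num) (by
    have : 0 < 1 / κ := by positivity
    linarith)

theorem linear_rescaling_conjShift {d : ℕ} (a y t : ℝ) (x : Eucl d) :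
    ((2 : ℝ) ^ t)⁻¹ • (radialMap (expProfile (conjShift L M a y)) (0 + (2 : ℝ) ^ t • x) -
      radialMap (expProfile (conjShift L M a y)) 0) =
      radialMap (expProfile (conjShift L M (a + t) y)) x := by
  rw [zero_add, radialMap_zero, sub_zero, smul_radialMap_expProfile_smul]
  congr 2
  ext s
  simp only [conjShift]
  rw [show s + t + a = s + (a + t) by ring]
  ring

/-- Translation by `n * P` commutes through `L` and `M`, so only the class of `a` modulo `P`
matters. -/
theorem conjShift_add_int_mul {P c : ℝ} (h : SlopePinched κ L) (hκ : 1 ≤ κ)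
    (hM : ∀ y, L (M y) = y) (hP : ∀ (s : ℝ) (n : ℤ), L (s + n * P) = L s + n * c) (a y : ℝ)
    (n : ℤ) : conjShift L M (a + n * P) y = conjShift L M a y := by
  ext s
  have : M (L (s + a) + n * c - y) = M (L (s + a) - y) + n * P := by
    apply (h.strictMono hκ).injective
    rw [hM, hP, hM]; ring
  simp only [conjShift]
  rw [← add_assoc, hP, this]
  ring

theorem continuous_conjShift_param {d : ℕ} (h : SlopePinched κ L) (hκ : 1 ≤ κ)
    (hM : ∀ y, L (M y) = y) (y : ℝ) (x : Eucl d) :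
    Continuous fun a : ℝ => (radialMap (expProfile (conjShift L M a y)) x : Eucl d) := by
  rcases eq_or_ne x 0 with rfl | hx
  · simp only [radialMap_zero]; exact continuous_const
  have hx' := norm_pos_iff.2 hx
  have hL := h.continuous hκ
  have hM' := (h.rightInverse hκ hM).continuous hκ
  simp only [radialMap, expProfile_of_pos _ hx']
  have hs : Continuous fun a : ℝ => conjShift L M a y (Real.logb 2 ‖x‖) := by
    simp only [conjShift]
    fun_prop
  exact ((continuous_const.rpow hs fun _ => Or.inl (by norm_num)).div_const _).smul
    continuous_const

/-- By periodicity the base points of the rescalings can be taken in the compact interval `[0, P]`.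
A subsequence converges to some `a`, and continuity in the base point identifies the limit
pointwise. -/
theorem exists_eq_of_mem_linearInfinitesimalSpace {d : ℕ} {P c : ℝ} (h : SlopePinched κ L)
    (hκ : 1 ≤ κ) (hM : ∀ y, L (M y) = y) (hP0 : 0 < P)
    (hP : ∀ (s : ℝ) (n : ℤ), L (s + n * P) = L s + n * c) {y : ℝ} {ψ : Eucl d → Eucl d}
    (hψ : ψ ∈ linearInfinitesimalSpace 0 (radialMap (expProfile (conjShift L M 0 y)))) :
    ∃ a, ψ = radialMap (expProfile (conjShift L M a y)) := by
  obtain ⟨t, ht, -, hlim⟩ := hψ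
  have hb : ∀ k, ∃ b ∈ Icc 0 P, ∀ x : Eucl d,
      (t k)⁻¹ • (radialMap (expProfile (conjShift L M 0 y)) (0 + t k • x) -
        radialMap (expProfile (conjShift L M 0 y)) 0) =
      radialMap (expProfile (conjShift L M b y)) x := by
    intro k
    set s := Real.logb 2 (t k) with hs
    -- The base point is `log₂ (t k)` reduced modulo `P`.
    refine ⟨Int.fract (s / P) * P, ⟨by positivity, ?_⟩, fun x => ?_⟩
    · exact mul_le_of_le_one_left hP0.le (Int.fract_lt_one _).le
    · rw [← two_rpow_logb (ht k), linear_rescaling_conjShift, zero_add, ← hs,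
        ← conjShift_add_int_mul h hκ hM hP (Int.fract (s / P) * P) y ⌊s / P⌋]
      congr 3
      rw [← add_mul, Int.fract_add_floor, div_mul_cancel₀ _ hP0.ne']
  choose b hb hbx using hb
  obtain ⟨a, -, σ, hσ, hconv⟩ := isCompact_Icc.tendsto_subseq hb
  refine ⟨a, funext fun x => ?_⟩
  have h1 := ((tendstoLocallyUniformlyOn_univ.2 hlim).tendsto_at (mem_univ x)).comp hσ.tendsto_atTop
  have h2 := ((continuous_conjShift_param h hκ hM y x).tendsto a).comp hconv
  refine tendsto_nhds_unique (h1.congr fun k => ?_) h2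
  simp only [Function.comp]
  exact hbx _ x

theorem isAttractingFixedPoint_conjShift {d : ℕ} (hd : 2 ≤ d) {P c : ℝ} (h : SlopePinched κ L)
    (hκ : 1 ≤ κ) (hM : ∀ y, L (M y) = y) (hP0 : 0 < P)
    (hP : ∀ (s : ℝ) (n : ℤ), L (s + n * P) = L s + n * c) :
    IsAttractingFixedPoint (radialMap (expProfile (conjShift L M 0 1)) : Eucl d → Eucl d) 0 := by
  refine ⟨radialMap_zero _, ⟨univ, univ_mem,
    ((h.conjShift hκ hM 0 1).powerPinched.injective_radialMap (by nlinarith)).injOn⟩, ?_, ?_⟩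
  · refine ⟨radialMap (expProfile (conjShift L M 0 1)), fun k => 2 ^ (((-k : ℤ) : ℝ) * P),
      fun k => by positivity, ?_, ?_⟩
    · have h1 : Tendsto (fun k : ℕ => ((2 : ℝ) ^ (-P)) ^ k) atTop (𝓝 0) :=
        tendsto_pow_atTop_nhds_zero_of_lt_one (by positivity)
          (Real.rpow_lt_one_of_one_lt_of_neg (by norm_num) (by linarith))
      refine h1.congr fun k => ?_
      rw [← Real.rpow_natCast, ← Real.rpow_mul (by norm_num)]
      congr 1
      push_cast; ring
    · simp_rw [linear_rescaling_conjShift, conjShift_add_int_mul h hκ hM hP]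
      exact fun u hu x => ⟨univ, univ_mem, .of_forall fun _ _ _ => refl_mem_uniformity hu⟩
  · intro ψ hψ
    obtain ⟨a, rfl⟩ := exists_eq_of_mem_linearInfinitesimalSpace h hκ hM hP0 hP hψ
    have : Nonempty (Fin d) := ⟨⟨0, by omega⟩⟩
    exact ⟨isUniformlyQuasiconformalOn_conjShift hd h hκ hM a 1 isOpen_univ isConnected_univ
      (mapsTo_univ _ _), isLoxodromicallyAttracting_conjShift h hκ hM a⟩

end conjShift

/-! ### The zigzag function -/

/-- The piecewise linear function whose slopes alternate between `1 / K` and `K` and which takes the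
value `-n` at `log₂ (radius K n)` for every integer `n`. -/
def zigzag (K s : ℝ) : ℝ :=
  2 * ⌊s / (K + 1 / K)⌋ + max (Int.fract (s / (K + 1 / K)) * (K + 1 / K) / K)
    (1 + K * (Int.fract (s / (K + 1 / K)) * (K + 1 / K) - K))

section zigzag

variable {K : ℝ}

theorem zigzag_cell (hK : 1 < K) (j : ℤ) {w : ℝ} (h0 : 0 ≤ w) (h1 : w ≤ K + 1 / K) :
    zigzag K (j * (K + 1 / K) + w) = 2 * j + max (w / K) (1 + K * (w - K)) := by
  have hP : 0 < K + 1 / K := by positivity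
  have e : (j * (K + 1 / K) + w) / (K + 1 / K) = w / (K + 1 / K) + j := by
    rw [add_div, mul_div_cancel_right₀ _ hP.ne', add_comm]
  rw [zigzag, e, Int.floor_add_intCast, Int.fract_add_intCast]
  -- The right endpoint belongs to the next cell for the floor function; the formulas agree because
  -- the maximum equals 2 there.
  rcases h1.eq_or_lt with rfl | h1
  · have h2 : 1 / (K * K) ≤ 1 := (div_le_one (by positivity)).2 (by nlinarith)
    rw [div_self hP.ne', Int.fract_one, Int.floor_one, max_eq_left, max_eq_right]
    · push_cast
      field_simp
      ring
    · have e1 : (K + 1 / K) / K = 1 + 1 / (K * K) := by field_simp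
      have e2 : 1 + K * (K + 1 / K - K) = 2 := by field_simp; ring
      rw [e1, e2]; linarith
    · simp; nlinarith
  · have hf : ⌊w / (K + 1 / K)⌋ = 0 :=
      Int.floor_eq_zero_iff.2 ⟨by positivity, (div_lt_one hP).2 h1⟩
    rw [Int.fract, hf]
    push_cast
    rw [sub_zero, div_mul_cancel₀ _ hP.ne', zero_add]

/-- The two branches of the maximum cross at `w = K`, both with value 1; before that the branch of
slope `1 / K` is the larger. -/
theorem zigzag_slow (hK : 1 < K) (m : ℤ) {w : ℝ} (h0 : 0 ≤ w) (h1 : w ≤ K) :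
    zigzag K (-(m * (K + 1 / K)) + w) = -(2 * m) + w / K := by
  have hc := zigzag_cell hK (-m) h0 (h1.trans (by have : 0 < 1 / K := by positivity
                                                  linarith))
  push_cast at hc
  rw [← neg_mul, hc, max_eq_left]
  · ring
  · rw [← sub_nonneg]
    have e : w / K - (1 + K * (w - K)) = (K - w) * (K - 1 / K) := by field_simp; ring
    rw [e]
    have : 1 / K ≤ K := by rw [div_le_iff₀ (by linarith)]; nlinarith
    exact mul_nonneg (by linarith) (by linarith)

theorem zigzag_fast (hK : 1 < K) (m : ℤ) {w : ℝ} (h0 : 0 ≤ w) (h1 : w ≤ 1 / K) :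
    zigzag K (-(m * (K + 1 / K)) - 1 / K + w) = -(2 * m) - 1 + K * w := by
  have hc := zigzag_cell (w := K + w) hK (-m - 1) (by linarith) (by linarith)
  push_cast at hc
  rw [show -(m * (K + 1 / K)) - 1 / K + w = (-m - 1) * (K + 1 / K) + (K + w) by ring, hc,
    max_eq_right]
  · ring
  · rw [← sub_nonneg]
    have e : 1 + K * (K + w - K) - (K + w) / K = w * (K - 1 / K) := by field_simp; ring
    rw [e]
    have : 1 / K ≤ K := by rw [div_le_iff₀ (by linarith)]; nlinarith
    exact mul_nonneg h0 (by linarith)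

theorem zigzag_add_int_mul (hK : 1 < K) (s : ℝ) (n : ℤ) :
    zigzag K (s + n * (K + 1 / K)) = zigzag K s + n * 2 := by
  have hP : 0 < K + 1 / K := by positivity
  have e : (s + n * (K + 1 / K)) / (K + 1 / K) = s / (K + 1 / K) + n := by
    rw [add_div, mul_div_cancel_right₀ _ hP.ne']
  rw [zigzag, zigzag, e, Int.floor_add_intCast, Int.fract_add_intCast]
  push_cast
  ring

theorem max_slope (hK : 1 < K) {u w : ℝ} (huw : u ≤ w) :
    (w - u) / K ≤ max (w / K) (1 + K * (w - K)) - max (u / K) (1 + K * (u - K)) ∧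
      max (w / K) (1 + K * (w - K)) - max (u / K) (1 + K * (u - K)) ≤ K * (w - u) := by
  have h1 : (w - u) / K ≤ K * (w - u) := by
    rw [div_le_iff₀ (by linarith)]
    nlinarith [mul_nonneg (sub_nonneg.2 huw) (by nlinarith : 0 ≤ K * K - 1)]
  have h2 : (w - u) / K = w / K - u / K := sub_div _ _ _
  constructor
  · rw [le_sub_iff_add_le, ← le_sub_iff_add_le', max_le_iff]
    constructor
    · linarith [le_max_left (w / K) (1 + K * (w - K))]
    · linarith [le_max_right (w / K) (1 + K * (w - K))]
  · rw [sub_le_iff_le_add, max_le_iff]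
    constructor
    · linarith [le_max_left (u / K) (1 + K * (u - K))]
    · linarith [le_max_right (u / K) (1 + K * (u - K))]

/-- Inside one cell this is `max_slope`. Otherwise split at the cell boundaries: whole cells have
mean slope `2 / (K + 1 / K)`, which also lies between `1 / K` and `K`. -/
theorem slopePinched_zigzag (hK : 1 < K) : SlopePinched K (zigzag K) := by
  have hP : 0 < K + 1 / K := by positivity
  have hcell : ∀ (j : ℤ) (s t : ℝ), j * (K + 1 / K) ≤ s → s ≤ t → t ≤ (j + 1) * (K + 1 / K) →
      (t - s) / K ≤ zigzag K t - zigzag K s ∧ zigzag K t - zigzag K s ≤ K * (t - s) := by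
    intro j s t h1 h2 h3
    obtain ⟨u, rfl⟩ : ∃ u, s = j * (K + 1 / K) + u := ⟨s - j * (K + 1 / K), by ring⟩
    obtain ⟨w, rfl⟩ : ∃ w, t = j * (K + 1 / K) + w := ⟨t - j * (K + 1 / K), by ring⟩
    rw [zigzag_cell hK j (by linarith) (by linarith), zigzag_cell hK j (by linarith) (by linarith),
      add_sub_add_left_eq_sub, add_sub_add_left_eq_sub]
    exact max_slope hK (by linarith)
  have hfl : ∀ s : ℝ, (⌊s / (K + 1 / K)⌋ : ℝ) * (K + 1 / K) ≤ s ∧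
      s ≤ (⌊s / (K + 1 / K)⌋ + 1) * (K + 1 / K) := fun s =>
    ⟨(le_div_iff₀ hP).1 (Int.floor_le _), (div_le_iff₀ hP).1 (Int.lt_floor_add_one _).le⟩
  have hint : ∀ n : ℤ, zigzag K (n * (K + 1 / K)) = n * 2 + zigzag K 0 := by
    intro n
    have := zigzag_add_int_mul hK 0 n
    rw [zero_add] at this
    rw [this]; ring
  intro s t hst
  obtain ⟨a1, a2⟩ := hfl s
  obtain ⟨b1, b2⟩ := hfl t
  have hij : ⌊s / (K + 1 / K)⌋ ≤ ⌊t / (K + 1 / K)⌋ := Int.floor_le_floor (by gcongr)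
  set i := ⌊s / (K + 1 / K)⌋
  set j := ⌊t / (K + 1 / K)⌋
  rcases hij.eq_or_lt with h | h
  · rw [← h] at b2
    exact hcell i s t a1 hst b2
  · have hij' : (i : ℝ) + 1 ≤ j := by exact_mod_cast h
    have c1 := hcell i s ((i + 1) * (K + 1 / K)) a1 a2 le_rfl
    have c2 := hcell j (j * (K + 1 / K)) t le_rfl b1 b2
    have e1 := hint (i + 1)
    have e2 := hint j
    push_cast at e1
    rw [e1] at c1
    rw [e2] at c2
    have d1 : ((j - (i + 1)) * (K + 1 / K) : ℝ) / K ≤ (j - (i + 1)) * 2 := by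
      rw [mul_div_assoc]
      have : 1 / (K * K) ≤ 1 := (div_le_one (by positivity)).2 (by nlinarith)
      have e1 : (K + 1 / K) / K = 1 + 1 / (K * K) := by field_simp
      exact mul_le_mul_of_nonneg_left (by linarith) (by linarith)
    have d2 : ((j - (i + 1)) * 2 : ℝ) ≤ K * ((j - (i + 1)) * (K + 1 / K)) := by
      have e : K * ((j - (i + 1)) * (K + 1 / K)) = ((j - (i + 1)) * (K * K + 1) : ℝ) := by
        field_simp
      rw [e]
      exact mul_le_mul_of_nonneg_left (by nlinarith) (by linarith)
    constructor
    · have e : (t - s) / K = ((i + 1) * (K + 1 / K) - s) / K +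
          (j - (i + 1)) * (K + 1 / K) / K + (t - j * (K + 1 / K)) / K := by ring
      rw [e]; linarith [c1.1, c2.1]
    · have e : K * (t - s) = K * ((i + 1) * (K + 1 / K) - s) +
          K * ((j - (i + 1)) * (K + 1 / K)) + K * (t - j * (K + 1 / K)) := by ring
      rw [e]; linarith [c1.2, c2.2]

/-! ### The radii -/

theorem radius_two_mul (K : ℝ) (m : ℤ) : radius K (2 * m) = 2 ^ (-(m * (K + 1 / K))) := by
  rw [radius, show (2 * m) / 2 = m by omega, show (2 * m + 1) / 2 = m by omega]
  congr 1
  ring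

theorem radius_two_mul_add_one (K : ℝ) (m : ℤ) :
    radius K (2 * m + 1) = 2 ^ (-(m * (K + 1 / K)) - 1 / K) := by
  rw [radius, show (2 * m + 1) / 2 = m by omega, show (2 * m + 1 + 1) / 2 = m + 1 by omega]
  congr 1
  push_cast
  ring

theorem radius_two_mul_sub_one (K : ℝ) (m : ℤ) :
    radius K (2 * m - 1) = 2 ^ (-(m * (K + 1 / K)) + K) := by
  rw [show 2 * m - 1 = 2 * (m - 1) + 1 by ring, radius_two_mul_add_one]
  congr 1
  push_cast
  ring

theorem isZigzagProfile_expProfile (hK : 1 < K) :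
    IsZigzagProfile K (expProfile (zigzag K)) := by
  refine ⟨expProfile_zero _, fun n _ r hr => ?_⟩
  have hhalf : (1 / 2 : ℝ) ^ n = 2 ^ (-(n : ℝ)) := by
    rw [Real.rpow_neg (by norm_num), Real.rpow_natCast, one_div, inv_pow]
  rw [hhalf]
  obtain ⟨m, hm | hm⟩ := n.even_or_odd'
  · have hm' : (n : ℤ) = 2 * (m : ℤ) := by exact_mod_cast hm
    have hmr : (n : ℝ) = 2 * m := by exact_mod_cast hm
    rw [hm', radius_two_mul_sub_one, radius_two_mul] at hr
    obtain ⟨s, hs, rfl⟩ := exists_two_rpow_eq hr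
    obtain ⟨w, rfl⟩ : ∃ w, s = -((m : ℤ) * (K + 1 / K)) + w := ⟨s + m * (K + 1 / K), by simp⟩
    rw [expProfile_two_rpow, zigzag_slow hK _ (by linarith [hs.1]) (by linarith [hs.2]), hm',
      radius_two_mul, expSeq, if_neg (by simp), hmr, ← Real.rpow_mul (by norm_num),
      ← Real.rpow_mul (by norm_num), ← Real.rpow_add (by norm_num), ← Real.rpow_add (by norm_num)]
    congr 1
    push_cast
    ring
  · have hm' : (n : ℤ) = 2 * (m : ℤ) + 1 := by exact_mod_cast hm
    have hmr : (n : ℝ) = 2 * m + 1 := by exact_mod_cast hm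
    rw [hm', add_sub_cancel_right, radius_two_mul_add_one, radius_two_mul] at hr
    obtain ⟨s, hs, rfl⟩ := exists_two_rpow_eq hr
    obtain ⟨w, rfl⟩ : ∃ w, s = -((m : ℤ) * (K + 1 / K)) - 1 / K + w :=
      ⟨s + m * (K + 1 / K) + 1 / K, by push_cast; ring⟩
    rw [expProfile_two_rpow, zigzag_fast hK _ (by linarith [hs.1]) (by linarith [hs.2]), hm',
      radius_two_mul_add_one, expSeq, if_pos (by simp), hmr, ← Real.rpow_mul (by norm_num),
      ← Real.rpow_mul (by norm_num), ← Real.rpow_add (by norm_num), ← Real.rpow_add (by norm_num)]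
    congr 1
    push_cast
    ring

/-! ### The conjugate of the translation by one -/

variable {M : ℝ → ℝ}

/-- Subtracting 1 from the value of `zigzag` carries a slow piece to the adjacent fast one, so the
slope is `1 / K` divided by `K`. -/
theorem conjShift_zigzag_slow (hK : 1 < K) (hM : ∀ y, zigzag K (M y) = y) (m : ℤ) {w : ℝ}
    (h0 : 0 ≤ w) (h1 : w ≤ K) :
    conjShift (zigzag K) M 0 1 (-(m * (K + 1 / K)) + w) =
      -(m * (K + 1 / K)) - 1 / K + w / K ^ 2 := by
  rw [conjShift, add_zero, sub_zero]
  apply ((slopePinched_zigzag hK).strictMono hK.le).injective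
  rw [hM, zigzag_slow hK m h0 h1, zigzag_fast hK m (by positivity)]
  · field_simp
    ring
  · rw [div_le_div_iff₀ (by positivity) (by positivity)]
    nlinarith

/-- Here a fast piece is carried to a slow one, and the slope is `K` divided by `1 / K`. -/
theorem conjShift_zigzag_fast (hK : 1 < K) (hM : ∀ y, zigzag K (M y) = y) (m : ℤ) {w : ℝ}
    (h0 : 0 ≤ w) (h1 : w ≤ 1 / K) :
    conjShift (zigzag K) M 0 1 (-(m * (K + 1 / K)) - 1 / K + w) =
      -(m * (K + 1 / K)) - (K + 1 / K) + K ^ 2 * w := by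
  rw [conjShift, add_zero, sub_zero]
  apply ((slopePinched_zigzag hK).strictMono hK.le).injective
  have h2 := zigzag_slow (w := K ^ 2 * w) hK (m + 1) (by positivity) (by
    rw [le_div_iff₀ (by linarith)] at h1
    nlinarith)
  push_cast at h2
  rw [hM, zigzag_fast hK m h0 h1,
    show -(m * (K + 1 / K)) - (K + 1 / K) = -(((m : ℝ) + 1) * (K + 1 / K)) by ring, h2]
  field_simp
  ring

/-! ### The limit profiles and the rescalings along even and odd radii. -/

/-- The base point is `log₂ r_0 = 0`, where the conjugated translation takes the value `-1 / K`;
adding `1 / K` normalizes it to fix 0. -/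
theorem isFirstLimitProfile_conjShift (hK : 1 < K) (hM : ∀ y, zigzag K (M y) = y) :
    IsFirstLimitProfile K
      (expProfile fun s => conjShift (zigzag K) M 0 1 s + 1 / K) := by
  intro m
  constructor
  · intro r hr
    rw [radius_two_mul_add_one, radius_two_mul] at hr
    obtain ⟨s, hs, rfl⟩ := exists_two_rpow_eq hr
    obtain ⟨w, rfl⟩ : ∃ w, s = -(m * (K + 1 / K)) - 1 / K + w :=
      ⟨s + m * (K + 1 / K) + 1 / K, by ring⟩
    rw [expProfile_two_rpow, conjShift_zigzag_fast hK hM m (by linarith [hs.1]) (by linarith [hs.2]),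
      radius_two_mul, ← Real.rpow_mul (by norm_num), ← Real.rpow_mul (by norm_num),
      ← Real.rpow_add (by norm_num)]
    congr 1
    field_simp
    ring
  · intro r hr
    rw [radius_two_mul_sub_one, radius_two_mul] at hr
    obtain ⟨s, hs, rfl⟩ := exists_two_rpow_eq hr
    obtain ⟨w, rfl⟩ : ∃ w, s = -(m * (K + 1 / K)) + w := ⟨s + m * (K + 1 / K), by ring⟩
    rw [expProfile_two_rpow, conjShift_zigzag_slow hK hM m (by linarith [hs.1]) (by linarith [hs.2]),
      radius_two_mul, ← Real.rpow_mul (by norm_num), ← Real.rpow_mul (by norm_num),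
      ← Real.rpow_add (by norm_num)]
    congr 1
    field_simp
    ring

/-- The base point is `log₂ r_{-1} = K`, which the conjugated translation sends to 0, so no additive
constant appears. -/
theorem isSecondLimitProfile_conjShift (hK : 1 < K) (hM : ∀ y, zigzag K (M y) = y) :
    IsSecondLimitProfile K
      (expProfile fun s => conjShift (zigzag K) M 0 1 (s + K)) := by
  intro m
  have hmid : (2 : ℝ) ^ (-K + 1 / K) * radius K (2 * m + 1) =
      2 ^ (-(m * (K + 1 / K)) - K) := by
    rw [radius_two_mul_add_one, ← Real.rpow_add (by norm_num)]
    congr 1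
    ring
  have hlow : radius K (2 * m + 2) = 2 ^ (-(m * (K + 1 / K)) - K - 1 / K) := by
    rw [show 2 * m + 2 = 2 * (m + 1) by ring, radius_two_mul]
    congr 1
    push_cast
    ring
  rw [hmid, hlow, radius_two_mul]
  constructor
  · intro r hr
    obtain ⟨s, hs, rfl⟩ := exists_two_rpow_eq hr
    obtain ⟨w, rfl⟩ : ∃ w, s = -(m * (K + 1 / K)) - K - 1 / K + w :=
      ⟨s + m * (K + 1 / K) + K + 1 / K, by ring⟩
    rw [expProfile_two_rpow, show -(m * (K + 1 / K)) - K - 1 / K + w + K =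
      -(m * (K + 1 / K)) - 1 / K + w by ring,
      conjShift_zigzag_fast hK hM m (by linarith [hs.1]) (by linarith [hs.2]),
      ← Real.rpow_mul (by norm_num), ← Real.rpow_mul (by norm_num), ← Real.rpow_add (by norm_num)]
    congr 1
    ring
  · intro r hr
    obtain ⟨s, hs, rfl⟩ := exists_two_rpow_eq hr
    obtain ⟨w, rfl⟩ : ∃ w, s = -(m * (K + 1 / K)) - K + w :=
      ⟨s + m * (K + 1 / K) + K, by ring⟩
    rw [expProfile_two_rpow, show -(m * (K + 1 / K)) - K + w + K = -(m * (K + 1 / K)) + w by ring,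
      conjShift_zigzag_slow hK hM m (by linarith [hs.1]) (by linarith [hs.2]),
      ← Real.rpow_mul (by norm_num), ← Real.rpow_mul (by norm_num), ← Real.rpow_add (by norm_num)]
    congr 1
    field_simp
    ring

theorem conjShift_zigzag_add_int_mul (hK : 1 < K) (hM : ∀ y, zigzag K (M y) = y) (n : ℤ) (s : ℝ) :
    conjShift (zigzag K) M 0 1 (s + n * (K + 1 / K)) =
      conjShift (zigzag K) M 0 1 s + n * (K + 1 / K) := by
  have h := congrFun (conjShift_add_int_mul (slopePinched_zigzag hK) hK.le hM
    (zigzag_add_int_mul hK) 0 1 n) s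
  simp only [conjShift, zero_add, add_zero, sub_zero] at h ⊢
  linarith

/-- The radii of even index differ by powers of the period `2 ^ (K + 1 / K)`, so the rescaled map
does not depend on `m`, and convergence is trivial. The odd radii behave alike. -/
theorem rescaled_conjShift_even {d : ℕ} (hd : 1 ≤ d) (hK : 1 < K)
    (hM : ∀ y, zigzag K (M y) = y) (m : ℤ) :
    rescaled (radialMap (expProfile (conjShift (zigzag K) M 0 1)) : Eucl d → Eucl d) 0
      (radius K (2 * m)) =
      radialMap (expProfile fun s => conjShift (zigzag K) M 0 1 s + 1 / K) := by
  have hper := conjShift_zigzag_add_int_mul hK hM (-m)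
  push_cast at hper
  rw [radius_two_mul, ← neg_mul,
    ((slopePinched_zigzag hK).conjShift hK.le hM 0 1).rescaled_eq hd (by nlinarith)]
  congr 2
  ext s
  have h0 := conjShift_zigzag_slow hK hM m (w := 0) le_rfl (by linarith)
  rw [add_zero, ← neg_mul] at h0
  rw [hper, h0]
  ring

theorem rescaled_conjShift_odd {d : ℕ} (hd : 1 ≤ d) (hK : 1 < K)
    (hM : ∀ y, zigzag K (M y) = y) (m : ℤ) :
    rescaled (radialMap (expProfile (conjShift (zigzag K) M 0 1)) : Eucl d → Eucl d) 0
      (radius K (2 * m - 1)) =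
      radialMap (expProfile fun s => conjShift (zigzag K) M 0 1 (s + K)) := by
  have hper := conjShift_zigzag_add_int_mul hK hM (-m)
  push_cast at hper
  rw [radius_two_mul_sub_one,
    ((slopePinched_zigzag hK).conjShift hK.le hM 0 1).rescaled_eq hd (by nlinarith)]
  congr 2
  ext s
  have h0 := conjShift_zigzag_slow hK hM m (w := K) (by linarith) le_rfl
  rw [show s + (-(m * (K + 1 / K)) + K) = (s + K) + -m * (K + 1 / K) by ring, hper, h0]
  field_simp
  ring

theorem radialMap_limitProfiles_ne {d : ℕ} (hd : 1 ≤ d) (hK : 1 < K)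
    (hM : ∀ y, zigzag K (M y) = y) :
    (radialMap (expProfile fun s => conjShift (zigzag K) M 0 1 s + 1 / K) : Eucl d → Eucl d) ≠
      radialMap (expProfile fun s => conjShift (zigzag K) M 0 1 (s + K)) := by
  intro h
  have hK' : 1 / K < K := by rw [div_lt_iff₀ (by linarith)]; nlinarith
  -- At this radius the logarithms of the two profiles are `-K` and `-1 / K ^ 3`, which agree only
  -- if `K ^ 4 = 1`.
  let x : Eucl d := (2 : ℝ) ^ (-(1 / K)) • EuclideanSpace.single ⟨0, hd⟩ 1
  have hx : ‖x‖ = 2 ^ (-(1 / K)) := by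
    rw [norm_smul, Real.norm_of_nonneg (by positivity)]; simp
  have h1 := congrArg norm (congrFun h x)
  rw [norm_radialMap_expProfile, norm_radialMap_expProfile, hx, expProfile_two_rpow,
    expProfile_two_rpow] at h1
  have h2 := congrArg (Real.logb 2) h1
  rw [Real.logb_rpow (by norm_num) (by norm_num), Real.logb_rpow (by norm_num) (by norm_num)] at h2
  have h3 := conjShift_zigzag_fast hK hM 0 (w := 0) le_rfl (by positivity)
  have h4 := conjShift_zigzag_slow hK hM 0 (w := K - 1 / K) (by linarith)
    (by have : 0 < 1 / K := by positivity
        linarith)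
  simp only [Int.cast_zero, zero_mul, neg_zero, zero_add, zero_sub, add_zero, mul_zero] at h3 h4
  rw [show -(1 / K) + K = K - 1 / K by ring, h3, h4] at h2
  field_simp at h2
  nlinarith [mul_pos (by linarith : 0 < K - 1) (by linarith : 0 < K - 1),
    mul_pos (by nlinarith : 0 < K ^ 2 - 1) (by nlinarith : 0 < K ^ 2 - 1)]

theorem two_rpow_neg_mul_add_tendsto (hK : 1 < K) (c : ℝ) :
    Tendsto (fun k : ℕ => (2 : ℝ) ^ (-(((k : ℤ) : ℝ) * (K + 1 / K)) + c)) atTop (𝓝 0) := by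
  have hP : 0 < K + 1 / K := by positivity
  have h1 : Tendsto (fun k : ℕ => ((2 : ℝ) ^ (-(K + 1 / K))) ^ k * 2 ^ c) atTop (𝓝 (0 * 2 ^ c)) :=
    (tendsto_pow_atTop_nhds_zero_of_lt_one (by positivity)
      (Real.rpow_lt_one_of_one_lt_of_neg (by norm_num) (by linarith))).mul_const _
  rw [zero_mul] at h1
  refine h1.congr fun k => ?_
  rw [← Real.rpow_natCast, ← Real.rpow_mul (by norm_num), ← Real.rpow_add (by norm_num)]
  congr 1
  push_cast
  ring

end zigzag

theorem tendstoLocallyUniformly_of_forall_eq {X Y : Type*} [TopologicalSpace X] [UniformSpace Y]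
    {F : ℕ → X → Y} {f : X → Y} (h : ∀ n, F n = f) : TendstoLocallyUniformly F f atTop :=
  fun u hu _ => ⟨univ, univ_mem, .of_forall fun n y _ => by
    rw [h n]; exact refl_mem_uniformity hu⟩

end

/-! ### Assembly of the example. -/

theorem theorem1p6 (d : ℕ) (hd : 2 ≤ d) (K : ℝ) (hK : 1 < K) :
    ∃ (f h Q₁ Q₂ : ℝ → ℝ) (F H : Eucl d → Eucl d),
      -- the radial quasiconformal map `F` of the ball onto itself
      IsZigzagProfile K f ∧ F = radialMap f ∧
      BijOn F (unitBall d) (unitBall d) ∧ IsQuasiconformalOn (K ^ (d - 1)) F (unitBall d) ∧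
      -- `H` is radial and is the conjugate by `F` of `x ↦ x / 2`
      MapsTo h (Icc 0 1) (Icc 0 1) ∧ (∀ r ∈ Icc (0 : ℝ) 1, f (h r) = f r / 2) ∧
      H = radialMap h ∧ (∀ x ∈ unitBall d, F (H x) = (1 / 2 : ℝ) • F x) ∧
      -- `H` is uniformly quasiconformal, with an attracting fixed point at `0`
      IsUniformlyQuasiconformalOn H (unitBall d) ∧
      IsAttractingFixedPoint H 0 ∧
      TendstoUniformlyOn (fun m : ℕ => H^[m]) (fun _ => 0) atTop (unitBall d) ∧
      -- `H` is not simple at `0`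
      ¬ IsSimpleAt H 0 ∧ (infinitesimalSpace 0 H).Nontrivial ∧
      -- two explicit distinct elements of the infinitesimal space
      IsFirstLimitProfile K Q₁ ∧ IsSecondLimitProfile K Q₂ ∧
      TendstoLocallyUniformly (fun k : ℕ => rescaled H 0 (radius K (2 * k))) (radialMap Q₁) atTop ∧
      TendstoLocallyUniformly (fun k : ℕ => rescaled H 0 (radius K (2 * k - 1)))
        (radialMap Q₂) atTop ∧
      (radialMap Q₁ : Eucl d → Eucl d) ∈ infinitesimalSpace 0 H ∧
      (radialMap Q₂ : Eucl d → Eucl d) ∈ infinitesimalSpace 0 H ∧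
      (radialMap Q₁ : Eucl d → Eucl d) ≠ radialMap Q₂ := by
  have hd1 : 1 ≤ d := by omega
  have hL := slopePinched_zigzag hK
  obtain ⟨M, hM⟩ : ∃ M : ℝ → ℝ, ∀ y, zigzag K (M y) = y :=
    (hL.surjective hK.le).hasRightInverse
  have hopen : IsOpen (unitBall d) := Metric.isOpen_ball
  have hconn : IsConnected (unitBall d) :=
    ⟨⟨0, by simp [unitBall]⟩, (convex_ball (0 : Eucl d) 1).isPreconnected⟩
  -- This normalization gives `f 1 = 1`, so that `F` maps the unit ball onto itself.
  have hL0 : zigzag K 0 = 0 := by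
    have := zigzag_slow hK 0 (w := 0) le_rfl (by linarith)
    simpa using this
  -- The form with `s + 0` matches `smul_radialMap_expProfile_smul` for `a = 0`, `b = 1`, which then
  -- yields the factor one half.
  have hcomp : zigzag K ∘ conjShift (zigzag K) M 0 1 = fun s => zigzag K (s + 0) - 1 := by
    ext s
    simp only [Function.comp, conjShift, sub_zero, hM]
  have hp := hL.powerPinched
  have hq := (hL.conjShift hK.le hM 0 1).powerPinched
  have hKK : 1 ≤ K * K := by nlinarith
  have T1 : TendstoLocallyUniformly
      (fun k : ℕ => rescaled (radialMap (expProfile (conjShift (zigzag K) M 0 1)) : Eucl d → Eucl d)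
        0 (radius K (2 * k)))
      (radialMap (expProfile fun s => conjShift (zigzag K) M 0 1 s + 1 / K)) atTop :=
    tendstoLocallyUniformly_of_forall_eq fun k => rescaled_conjShift_even hd1 hK hM k
  have T2 : TendstoLocallyUniformly
      (fun k : ℕ => rescaled (radialMap (expProfile (conjShift (zigzag K) M 0 1)) : Eucl d → Eucl d)
        0 (radius K (2 * k - 1)))
      (radialMap (expProfile fun s => conjShift (zigzag K) M 0 1 (s + K))) atTop :=
    tendstoLocallyUniformly_of_forall_eq fun k => rescaled_conjShift_odd hd1 hK hM k
  have m1 : (radialMap (expProfile fun s => conjShift (zigzag K) M 0 1 s + 1 / K) :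
      Eucl d → Eucl d) ∈
      infinitesimalSpace 0 (radialMap (expProfile (conjShift (zigzag K) M 0 1))) := by
    refine ⟨fun k => radius K (2 * k), fun k => ?_, ?_, T1⟩
    · simp only [radius_two_mul]; positivity
    · simpa only [radius_two_mul, add_zero] using two_rpow_neg_mul_add_tendsto hK 0
  have m2 : (radialMap (expProfile fun s => conjShift (zigzag K) M 0 1 (s + K)) :
      Eucl d → Eucl d) ∈
      infinitesimalSpace 0 (radialMap (expProfile (conjShift (zigzag K) M 0 1))) := by
    refine ⟨fun k => radius K (2 * k - 1), fun k => ?_, ?_, T2⟩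
    · simp only [radius_two_mul_sub_one]; positivity
    · simpa only [radius_two_mul_sub_one] using two_rpow_neg_mul_add_tendsto hK K
  have hne := radialMap_limitProfiles_ne hd1 hK hM
  have hone : expProfile (zigzag K) 1 = 1 := by
    rw [expProfile_of_pos _ one_pos, Real.logb_one, hL0, Real.rpow_zero]
  have hhalf : ∀ r : ℝ, expProfile (zigzag K) (expProfile (conjShift (zigzag K) M 0 1) r) =
      expProfile (zigzag K) r / 2 := by
    intro r
    rw [expProfile_comp, hcomp]
    rcases le_or_gt r 0 with h | h
    · simp [expProfile, h]
    · rw [expProfile_of_pos _ h, expProfile_of_pos _ h, add_zero,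
        Real.rpow_sub_one (by norm_num)]
  refine ⟨expProfile (zigzag K), expProfile (conjShift (zigzag K) M 0 1), _, _, _, _,
    isZigzagProfile_expProfile hK, rfl, ⟨?_, (hp.injective_radialMap hK.le).injOn, ?_⟩,
    hp.isQuasiconformalOn_radialMap hK.le hd hopen hconn, ?_, fun r _ => hhalf r, rfl, ?_,
    isUniformlyQuasiconformalOn_conjShift hd hL hK.le hM 0 1 hopen hconn
      (mapsTo_unitBall_conjShift hL hK.le hM 0),
    isAttractingFixedPoint_conjShift hd hL hK.le hM (by positivity) (zigzag_add_int_mul hK),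
    tendstoUniformlyOn_iterate_conjShift hL hK.le hM 0, ?_, ⟨_, m1, _, m2, hne⟩,
    isFirstLimitProfile_conjShift hK hM, isSecondLimitProfile_conjShift hK hM, T1, T2, m1, m2, hne⟩
  · rw [mapsTo_iff_image_subset, unitBall, hL.image_ball hK.le one_pos, hone]
  · rw [SurjOn, unitBall, hL.image_ball hK.le one_pos, hone]
  · intro r hr
    refine ⟨hq.nonneg hr.1, (hq.mono hKK hr.1 hr.2).trans ?_⟩
    rw [expProfile_of_pos _ one_pos, Real.logb_one]
    refine Real.rpow_le_one_of_one_le_of_nonpos (by norm_num) ?_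
    refine (conjShift_le hL hK.le hM 0 0 zero_le_one).trans ?_
    have : 0 < 1 / K := by positivity
    linarith
  · intro x _
    rw [radialMap_expProfile_comp, hcomp, ← smul_radialMap_expProfile_smul]
    simp
  · rintro ⟨ψ, hψ⟩
    rw [hψ] at m1 m2
    exact hne (m1.trans m2.symm)
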